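/- Fix $r\ge 1$, a probability distribution $P$ on $[r]=\{1,\dots,r\}$ and a channel (stochastic matrix) $W$ from $[r]$ to $[r]$. For $n\ge 1$ let $\mathbf X=(X_1,\dots,X_n)$ be i.i.d. with law $P$, let $\tilde{\mathbf Y}$ be the output of the memoryless channel $W$ with input $\mathbf X$, and let the received sequence be $Y_i=\tilde Y_{i+\pi \bmod n}$, where the unknown delay $\pi$ is uniform on a set $\Pi\subseteq\mathbb Z/n\mathbb Z$ of possible delays with $|\Pi|\ge 2$ and is independent of $(\mathbf X,\tilde{\mathbf Y})$. The error probability of an estimator $\Phi(\mathbf X,\mathbf Y)$ of the delay is $P_e(\Phi)=\Pr[\Phi(\mathbf X,\mathbf Y)\ne\pi]$. The max mutual information (MMI) decoder, with any rule for breaking ties, outputs a $\hat\pi\in\Pi$ that maximizes the empirical mutual information $\hat I(\mathbf X;\mathbf Y^{(\hat\pi)})$, where $Y^{(\hat\pi)}_i=Y_{i-\hat\pi \bmod n}$. Let $\kappa=\kappa(\Pi)$ be the maximum number of permutation cycles (of the index set $\mathbb Z/n\mathbb Z$) of the relative shift $i\mapsto i+\pi'-\pi$ between two distinct delays $\pi,\pi'\in\Pi$;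 if $\Pi$ is a subgroup, this is the maximum number of cycles of a nonzero delay in $\Pi$. Then there is a real number $\mathcal E^*$, depending only on $P$ and $W$, which is the optimal error exponent: for every sequence of delay sets $\Pi_n\subseteq\mathbb Z/n\mathbb Z$ with $|\Pi_n|\ge2$ for all large $n$ and $\kappa(\Pi_n)=o(n/\log n)$, $$\lim_{n\to\infty}-\frac1n\log_2\min_{\Phi}P_e(\Phi)=\mathcal E^*,$$ the minimum being over all estimators, which may depend on $P$ and $W$. Moreover, for every $n$, every $\Pi\subseteq\mathbb Z/n\mathbb Z$ with $|\Pi|\ge 2$ and $\kappa=\kappa(\Pi)$, the MMI decoder satisfies $$-\frac1n\log_2P_e(\Phi_{\mathrm{MMI}})\ \ge\ \mathcal E^*-\frac{\kappa}{n}\,r^2(r+1)\log_2\Big(1+\frac n\kappa\Big)-r^3\,\frac{\log_2(1+n)}{n}-\frac{\kappa}{n}\log_2 r-\frac1n\log_2\kappa .$$ -/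

import Mathlib

open Filter Topology Asymptotics

namespace DelayEstimation

/-- The cyclic shift `i ↦ i + d` (mod `n`) of the index set, as a permutation. -/
def delayPerm {n : ℕ} (d : Fin n) : Equiv.Perm (Fin n) := finRotate n ^ (d : ℕ)

/-- The number of permutation cycles of `σ`; a fixed point is a cycle of length one. -/
noncomputable def numCycles {n : ℕ} (σ : Equiv.Perm (Fin n)) : ℕ :=
  Nat.card (Quotient (Equiv.Perm.SameCycle.setoid σ))

/-- The maximum number of permutation cycles for a set `D` of possible delays: the largest number
of cycles of the relative shift between two distinct delays of `D`. When `D` is a group of delays,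
this is the largest number of cycles of a delay of `D` other than the identity. -/
noncomputable def maxCycles {n : ℕ} (D : Finset (Fin n)) : ℕ :=
  D.offDiag.sup fun p => numCycles ((delayPerm p.1)⁻¹ * delayPerm p.2)

/-- A (deterministic) delay estimator: it observes the source sequence and the received one. -/
abbrev Decoder (n r : ℕ) : Type := (Fin n → Fin r) → (Fin n → Fin r) → Fin n

/-- Probability that the i.i.d. source with law `P` emits `x` and that the memoryless channel `W`,
before the delay, outputs `z`. -/
def seqProb {n r : ℕ} (P : Fin r → ℝ) (W : Fin r → Fin r → ℝ) (x z : Fin n → Fin r) : ℝ :=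
  ∏ i, P (x i) * W (x i) (z i)

/-- Error probability of `φ` when the delay `d` is uniform on `D`: the received sequence is
`y i = z (i + d)`, where `z` is the channel output. -/
noncomputable def errorProb {n r : ℕ} (P : Fin r → ℝ) (W : Fin r → Fin r → ℝ)
    (D : Finset (Fin n)) (φ : Decoder n r) : ℝ :=
  (1 / (D.card : ℝ)) * ∑ d ∈ D, ∑ x : Fin n → Fin r, ∑ z : Fin n → Fin r,
    if φ x (z ∘ delayPerm d) = d then 0 else seqProb P W x z

/-- The smallest error probability over all decoders, which may depend on `P` and `W`. -/
noncomputable def optimalErrorProb {n r : ℕ} (P : Fin r → ℝ) (W : Fin r → Fin r → ℝ)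
    (D : Finset (Fin n)) : ℝ :=
  ⨅ φ : Decoder n r, errorProb P W D φ

/-- The joint empirical distribution (type) of a pair of sequences. -/
noncomputable def empDist {n r : ℕ} (x y : Fin n → Fin r) (a b : Fin r) : ℝ :=
  ((Finset.univ.filter fun i => x i = a ∧ y i = b).card : ℝ) / n

/-- Mutual information, in bits, of a joint distribution `q`. -/
noncomputable def mutualInfo {r : ℕ} (q : Fin r → Fin r → ℝ) : ℝ :=
  ∑ a, ∑ b, q a b * Real.logb 2 (q a b / ((∑ b', q a b') * ∑ a', q a' b))

/-- `φ` is a max mutual information decoder (with any tie-breaking) for the delay set `D`: it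
picks a delay of `D` that maximizes the empirical mutual information between the source sequence
and the received sequence with that delay undone. -/
def IsMMI {n r : ℕ} (D : Finset (Fin n)) (φ : Decoder n r) : Prop :=
  ∀ x y, φ x y ∈ D ∧ ∀ d ∈ D,
    mutualInfo (empDist x (y ∘ (delayPerm d).symm)) ≤
      mutualInfo (empDist x (y ∘ (delayPerm (φ x y)).symm))

/-- `E` is the exponent `lim -(1/n) log₂ (p n)` of the sequence `p` of error probabilities. -/
def IsErrorExponent (p : ℕ → ℝ) (E : ℝ) : Prop :=
  Tendsto (fun n : ℕ => -(1 / (n : ℝ)) * Real.logb 2 (p n)) atTop (𝓝 E)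

/-- A sequence of sets of possible delays that leave something to be estimated and whose maximum
number of cycles is `o(n / log n)`. -/
def Admissible (D : (n : ℕ) → Finset (Fin n)) : Prop :=
  (∀ᶠ n in atTop, 2 ≤ (D n).card) ∧
    (fun n : ℕ => (maxCycles (D n) : ℝ)) =o[atTop] fun n : ℕ => (n : ℝ) / Real.log n

/-- `E` is the optimal error exponent of delay estimation for source law `P` and channel `W`:
the exponent of the optimal error probability along every admissible sequence of delay sets. -/
def IsOptimalErrorExponent {r : ℕ} (P : Fin r → ℝ) (W : Fin r → Fin r → ℝ) (E : ℝ) : Prop :=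
  ∀ D : (n : ℕ) → Finset (Fin n), Admissible D →
    IsErrorExponent (fun n => optimalErrorProb P W (D n)) E

end DelayEstimation

/-!
Write `M(a,b) = P(a) W(b|a)` and let `ρ` be the largest eigenvalue of the Gram matrix
`K(b,b') = ∑ₐ √M(a,b) √M(a,b')`, that is, the squared operator norm of `√M`. The optimal exponent
is `-log₂ ρ`.

Two delays whose relative shift is `σ` are confused when the pairs `(xᵢ, zᵢ)` and `(xᵢ, z_{σ i})`
look alike. Once the source letters are summed out, sums over `(x, z)` of products over `i` of
functions of `(xᵢ, zᵢ, z_{σ i})` become partition functions `∑_z ∏ᵢ K'(zᵢ, z_{σ i})`, which factor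
as `∏ tr(K' ^ ℓ)` over the cycles of `σ`, with `ℓ` the cycle length (`partitionFn_eq_prod_trace`).
A positive vector `u` with `K' u ≤ z u` bounds them by `r ^ (number of cycles) * z ^ n`
(`partitionFn_le`).

*Achievability.* For the joint types `q` of `(x, z)` and `q'` of `(x, z ∘ σ)`, the product over
`i` of `q(xᵢ,zᵢ) q'(xᵢ,z_{σ i}) / (qX(xᵢ) qY(zᵢ))` is constant on the class of `(q, q')`, and its
sum over all `(x, z)` is the partition function of a substochastic kernel, hence at most
`r ^ (number of cycles)`. Since `q` and `q'` have the same marginals, `I(q) ≤ I(q')` means that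
`q'` has at most the joint entropy of `q`, and the likelihood is then at most
`2 ^ (-n (D(q‖M) + I(q)))` times that product. Finally `D(q‖M) + I(q) ≥ -log₂ ρ` by Jensen's
inequality and Cauchy–Schwarz for `√M` (`sum_mul_log_le`). Summing over pairs of types and wrong
delays costs only a polynomial factor, which the error terms of the theorem dominate because
`(1 + n/κ)^κ ≥ 1 + n`.

*Converse.* The error probability is at least `1/n` times the overlap `∑ min(p, p')` of the laws
under two delays. The minimum is compared with `√(p p')` and with the tilted products
`p^(1/2±s) p'^(1/2∓s)`. The sum of `√(p p')` is at least `ρ ^ n`, since `tr(K ^ ℓ) ≥ ρ ^ ℓ` for a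
positive semidefinite `K`. The tilted sums are governed by the nonsymmetric kernels `K_s`, whose
quadratic form exceeds that of `K` by a factor `exp(O(s²))` only, the first-order term in `s`
being antisymmetric (`tiltedKernel_quad_le`). A maximum principle turns a bound on the quadratic
form of a nonnegative matrix into a positive `u` with `K_s u ≤ z u` (`exists_pos_superharmonic`).
With `s` small, the overlap is at least `ρ ^ n exp(-δ n)` as soon as the number of cycles is a
small fraction of `n` (`exists_overlap_ge`).
-/

namespace DelayEstimation

/-! ### Partition functions of permutations -/

section PartitionFunction

variable {ι α : Type*} [Fintype ι] [Fintype α] [DecidableEq α]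

/-- The partition function of the pair interaction `K` along the arrows `i ↦ σ i`. -/
def partitionFn [DecidableEq ι] (σ : Equiv.Perm ι) (K : Matrix α α ℝ) : ℝ :=
  ∑ f : ι → α, ∏ i, K (f i) (f (σ i))

/-- Closing a path of length `m` with `B` gives the trace of `K ^ m * B`. -/
lemma sum_path_eq_trace (K : Matrix α α ℝ) (m : ℕ) (B : Matrix α α ℝ) :
    ∑ h : Fin (m + 1) → α, (∏ k : Fin m, K (h k.castSucc) (h k.succ)) * B (h (Fin.last m)) (h 0)
      = (K ^ m * B).trace := by
  induction m generalizing B with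
  | zero =>
    rw [← (Equiv.funUnique (Fin 1) α).symm.sum_comp]
    simp [Matrix.trace]
  | succ m ih =>
    have hKB : (K ^ (m + 1) * B).trace = (K ^ m * (K * B)).trace := by
      rw [pow_succ, mul_assoc]
    rw [hKB, ← ih (K * B), ← (Fin.snocEquiv fun _ => α).sum_comp, Fintype.sum_prod_type,
      Finset.sum_comm]
    refine Finset.sum_congr rfl fun h _ => ?_
    rw [Matrix.mul_apply, Finset.mul_sum]
    refine Finset.sum_congr rfl fun y _ => ?_
    have h0 : (Fin.snoc h y : Fin (m + 2) → α) 0 = h 0 := by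
      rw [← Fin.castSucc_zero, Fin.snoc_castSucc (α := fun _ => α)]
    have hl : (Fin.snoc h y : Fin (m + 2) → α) (Fin.last m).succ = y := by
      rw [Fin.succ_last, Fin.snoc_last (α := fun _ => α)]
    simp only [Fin.snocEquiv_apply]
    rw [Fin.prod_univ_castSucc]
    simp only [Fin.succ_castSucc, Fin.snoc_castSucc (α := fun _ => α),
      Fin.snoc_last (α := fun _ => α), h0, hl]
    ring

/-- The partition function of a single cycle of length `m`. -/
lemma sum_cycle_eq_trace (K : Matrix α α ℝ) {m : ℕ} (hm : 0 < m) :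
    ∑ h : Fin m → α, ∏ k, K (h k) (h (finRotate m k)) = (K ^ m).trace := by
  obtain ⟨m, rfl⟩ := Nat.exists_eq_succ_of_ne_zero hm.ne'
  rw [Nat.succ_eq_add_one, pow_succ, ← sum_path_eq_trace]
  refine Finset.sum_congr rfl fun h _ => ?_
  rw [Fin.prod_univ_castSucc, finRotate_last]
  congr 1
  refine Finset.prod_congr rfl fun k _ => ?_
  rw [finRotate_apply, Fin.coeSucc_eq_succ]

/-- The length of the cycle of `σ` through the class `q`. -/
noncomputable def cycleLength (σ : Equiv.Perm ι)
    (q : Quotient (Equiv.Perm.SameCycle.setoid σ)) : ℕ :=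
  Function.minimalPeriod σ q.out

lemma cycleLength_pos (σ : Equiv.Perm ι) (q : Quotient (Equiv.Perm.SameCycle.setoid σ)) :
    0 < cycleLength σ q := by
  refine Function.minimalPeriod_pos_of_mem_periodicPts ?_
  refine ⟨orderOf σ, orderOf_pos σ, ?_⟩
  rw [Function.IsPeriodicPt, Function.IsFixedPt, Equiv.Perm.iterate_eq_pow, pow_orderOf_eq_one]
  rfl

lemma cycleParam_bijective (σ : Equiv.Perm ι) :
    Function.Bijective
      (fun p : Σ q : Quotient (Equiv.Perm.SameCycle.setoid σ), Fin (cycleLength σ q) =>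
        σ^[(p.2 : ℕ)] p.1.out) := by
  constructor
  · rintro ⟨q, j⟩ ⟨q', k⟩ h
    have hq : q = q' := by
      rw [← q.out_eq, ← q'.out_eq]
      refine Quotient.sound (?_ : Equiv.Perm.SameCycle σ q.out q'.out)
      have h' : (σ ^ (j : ℕ)) q.out = (σ ^ (k : ℕ)) q'.out := by
        simpa only [Equiv.Perm.iterate_eq_pow] using h
      have h1 : Equiv.Perm.SameCycle σ q.out ((σ ^ (j : ℕ)) q.out) :=
        Equiv.Perm.sameCycle_pow_right.2 (Equiv.Perm.SameCycle.refl _ _)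
      rw [h'] at h1
      exact Equiv.Perm.sameCycle_pow_right.1 h1
    subst hq
    have := (Function.iterate_injOn_Iio_minimalPeriod (f := σ) (x := q.out))
      (Set.mem_Iio.2 j.2) (Set.mem_Iio.2 k.2) h
    rw [Fin.ext this]
  · intro x
    set q : Quotient (Equiv.Perm.SameCycle.setoid σ) := Quotient.mk _ x with hq
    have hx : Equiv.Perm.SameCycle σ q.out x := by
      have h : Quotient.mk (Equiv.Perm.SameCycle.setoid σ) q.out = Quotient.mk _ x := q.out_eq
      exact Quotient.exact h
    obtain ⟨i, hi⟩ := hx.exists_nat_pow_eq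
    refine ⟨⟨q, ⟨i % cycleLength σ q, Nat.mod_lt _ (cycleLength_pos σ q)⟩⟩, ?_⟩
    simp only [cycleLength]
    rw [Function.iterate_mod_minimalPeriod_eq, Equiv.Perm.iterate_eq_pow, hi]

/-- The index set laid out along the cycles of `σ`. -/
noncomputable def cycleParam (σ : Equiv.Perm ι) :
    (Σ q : Quotient (Equiv.Perm.SameCycle.setoid σ), Fin (cycleLength σ q)) ≃ ι :=
  Equiv.ofBijective _ (cycleParam_bijective σ)

lemma apply_cycleParam (σ : Equiv.Perm ι) (q : Quotient (Equiv.Perm.SameCycle.setoid σ))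
    (k : Fin (cycleLength σ q)) :
    σ (cycleParam σ ⟨q, k⟩) = cycleParam σ ⟨q, finRotate _ k⟩ := by
  change σ (σ^[(k : ℕ)] q.out) = σ^[((finRotate _ k : Fin _) : ℕ)] q.out
  rw [← Function.iterate_succ_apply' σ]
  have key : ∀ m (hm : m = cycleLength σ q) (k : Fin m),
      σ^[(k : ℕ) + 1] q.out = σ^[((finRotate m k : Fin m) : ℕ)] q.out := by
    intro m hm k
    obtain ⟨m, rfl⟩ := Nat.exists_eq_succ_of_ne_zero (n := m) (by have := k.2; omega)
    induction k using Fin.lastCases with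
    | last =>
      rw [finRotate_last, Fin.val_last]
      change σ^[m.succ] q.out = q.out
      rw [hm, cycleLength, Function.iterate_minimalPeriod]
    | cast k =>
      rw [finRotate_apply, Fin.coeSucc_eq_succ, Fin.val_castSucc, Fin.val_succ]
  exact key _ rfl k

lemma sum_cycleLength (σ : Equiv.Perm ι)
    [Fintype (Quotient (Equiv.Perm.SameCycle.setoid σ))] :
    ∑ q, cycleLength σ q = Fintype.card ι := by
  rw [← Fintype.card_congr (cycleParam σ), Fintype.card_sigma]
  simp

/-- The partition function factors over the cycles. -/
lemma partitionFn_eq_prod_trace [DecidableEq ι] (σ : Equiv.Perm ι)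
    [Fintype (Quotient (Equiv.Perm.SameCycle.setoid σ))] (K : Matrix α α ℝ) :
    partitionFn σ K = ∏ q, (K ^ cycleLength σ q).trace := by
  classical
  simp_rw [← sum_cycle_eq_trace K (cycleLength_pos σ _)]
  rw [Finset.prod_univ_sum, Fintype.piFinset_univ, partitionFn,
    ← ((cycleParam σ).arrowCongr (Equiv.refl α)).sum_comp,
    ← (Equiv.piCurry fun (q : Quotient (Equiv.Perm.SameCycle.setoid σ))
      (_ : Fin (cycleLength σ q)) => α).symm.sum_comp]
  refine Finset.sum_congr rfl fun g _ => ?_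
  have hg : ∀ p, ((cycleParam σ).arrowCongr (Equiv.refl α)) (Sigma.uncurry g) (cycleParam σ p)
      = g p.1 p.2 := by
    intro p
    change Sigma.uncurry g ((cycleParam σ).symm (cycleParam σ p)) = _
    rw [Equiv.symm_apply_apply]
    rfl
  rw [← (cycleParam σ).prod_comp, Fintype.prod_sigma]
  refine Finset.prod_congr rfl fun q _ => Finset.prod_congr rfl fun k _ => ?_
  rw [apply_cycleParam, Equiv.piCurry_symm_apply, hg, hg]

/-- A positive vector with `K u ≤ z u` bounds the diagonal of every power of `K`. -/
lemma trace_pow_le {K : Matrix α α ℝ} (hK : ∀ a b, 0 ≤ K a b) {u : α → ℝ} (hu : ∀ a, 0 < u a)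
    {z : ℝ} (hz : 0 ≤ z) (hKu : ∀ a, ∑ b, K a b * u b ≤ z * u a) (m : ℕ) :
    0 ≤ (K ^ m).trace ∧ (K ^ m).trace ≤ Fintype.card α * z ^ m := by
  have hnn : ∀ m a b, 0 ≤ (K ^ m) a b := by
    intro m
    induction m with
    | zero => intro a b; rw [pow_zero, Matrix.one_apply]; split_ifs <;> norm_num
    | succ m ih =>
      intro a b
      rw [pow_succ, Matrix.mul_apply]
      exact Finset.sum_nonneg fun c _ => mul_nonneg (ih a c) (hK c b)
  have hpow : ∀ m a, ∑ b, (K ^ m) a b * u b ≤ z ^ m * u a := by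
    intro m
    induction m with
    | zero => intro a; simp [Matrix.one_apply]
    | succ m ih =>
      intro a
      calc ∑ b, (K ^ (m + 1)) a b * u b = ∑ c, (K ^ m) a c * ∑ b, K c b * u b := by
            simp_rw [pow_succ, Matrix.mul_apply, Finset.sum_mul, Finset.mul_sum]
            rw [Finset.sum_comm]
            simp_rw [mul_assoc]
        _ ≤ ∑ c, (K ^ m) a c * (z * u c) :=
            Finset.sum_le_sum fun c _ => mul_le_mul_of_nonneg_left (hKu c) (hnn m a c)
        _ = z * ∑ c, (K ^ m) a c * u c := by
            rw [Finset.mul_sum]; exact Finset.sum_congr rfl fun c _ => by ring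
        _ ≤ z * (z ^ m * u a) := mul_le_mul_of_nonneg_left (ih a) hz
        _ = z ^ (m + 1) * u a := by ring
  refine ⟨Finset.sum_nonneg fun a _ => hnn m a a, ?_⟩
  calc (K ^ m).trace ≤ ∑ _a : α, z ^ m := by
        refine Finset.sum_le_sum fun a _ => le_of_mul_le_mul_right ?_ (hu a)
        exact (Finset.single_le_sum (f := fun b => (K ^ m) a b * u b)
          (fun b _ => mul_nonneg (hnn m a b) (hu b).le) (Finset.mem_univ a)).trans (hpow m a)
    _ = Fintype.card α * z ^ m := by simp

lemma partitionFn_le {n : ℕ} (σ : Equiv.Perm (Fin n)) {K : Matrix α α ℝ}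
    (hK : ∀ a b, 0 ≤ K a b) {u : α → ℝ} (hu : ∀ a, 0 < u a) {z : ℝ} (hz : 0 ≤ z)
    (hKu : ∀ a, ∑ b, K a b * u b ≤ z * u a) :
    partitionFn σ K ≤ (Fintype.card α : ℝ) ^ numCycles σ * z ^ n := by
  classical
  have := Fintype.ofFinite (Quotient (Equiv.Perm.SameCycle.setoid σ))
  rw [partitionFn_eq_prod_trace]
  calc ∏ q, (K ^ cycleLength σ q).trace ≤ ∏ q, ((Fintype.card α : ℝ) * z ^ cycleLength σ q) :=
        Finset.prod_le_prod (fun q _ => (trace_pow_le hK hu hz hKu _).1)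
          fun q _ => (trace_pow_le hK hu hz hKu _).2
    _ = _ := by
        rw [Finset.prod_mul_distrib, Finset.prod_pow_eq_pow_sum, sum_cycleLength, numCycles,
          Nat.card_eq_fintype_card]
        simp

lemma le_partitionFn {n : ℕ} (σ : Equiv.Perm (Fin n)) {K : Matrix α α ℝ} {z : ℝ} (hz : 0 ≤ z)
    (hKz : ∀ m, z ^ m ≤ (K ^ m).trace) : z ^ n ≤ partitionFn σ K := by
  classical
  have := Fintype.ofFinite (Quotient (Equiv.Perm.SameCycle.setoid σ))
  rw [partitionFn_eq_prod_trace]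
  calc z ^ n = ∏ q, z ^ cycleLength σ q := by
        rw [Finset.prod_pow_eq_pow_sum, sum_cycleLength]; simp
    _ ≤ _ := Finset.prod_le_prod (fun q _ => pow_nonneg hz _) fun q _ => hKz _

end PartitionFunction

/-! ### Spectral bounds for nonnegative matrices -/

section Spectral

variable {α : Type*} [Fintype α] [DecidableEq α]

open Matrix in
/-- The largest eigenvalue of a positive semidefinite matrix bounds the quadratic form, and its
powers are at most the traces of the powers of the matrix. -/
lemma exists_topEigenvalue [Nonempty α] {K : Matrix α α ℝ} (hK : K.PosSemidef) :
    ∃ ρ : ℝ, 0 ≤ ρ ∧ (∀ v : α → ℝ, v ⬝ᵥ K *ᵥ v ≤ ρ * (v ⬝ᵥ v)) ∧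
      ∀ m, ρ ^ m ≤ (K ^ m).trace := by
  obtain ⟨j, hj⟩ := Finite.exists_max hK.1.eigenvalues
  have hnn := hK.eigenvalues_nonneg
  have hspec := hK.1.spectral_theorem
  set U := hK.1.eigenvectorUnitary with hU
  refine ⟨hK.1.eigenvalues j, hnn j, fun v => ?_, fun m => ?_⟩
  · set w := (star (U : Matrix α α ℝ)) *ᵥ v with hw
    have hUt : (star (U : Matrix α α ℝ)) = (U : Matrix α α ℝ)ᵀ := by
      rw [Matrix.star_eq_conjTranspose, Matrix.conjTranspose_eq_transpose_of_trivial]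
    have hvw : v ᵥ* (U : Matrix α α ℝ) = w := by
      rw [hw, hUt, Matrix.mulVec_transpose]
    have h1 : v ⬝ᵥ K *ᵥ v = ∑ i, hK.1.eigenvalues i * (w i * w i) := by
      conv_lhs => rw [hspec, Unitary.conjStarAlgAut_apply]
      rw [← Matrix.mulVec_mulVec, ← Matrix.mulVec_mulVec, Matrix.dotProduct_mulVec, hvw, ← hw]
      simp only [dotProduct, Matrix.mulVec_diagonal]
      refine Finset.sum_congr rfl fun i _ => ?_
      simp
      ring
    have h2 : v ⬝ᵥ v = w ⬝ᵥ w := by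
      nth_rewrite 1 [← hvw]
      rw [hw, ← Matrix.dotProduct_mulVec, Matrix.mulVec_mulVec, Unitary.mul_star_self_of_mem U.2,
        Matrix.one_mulVec]
    rw [h1, h2, dotProduct, Finset.mul_sum]
    exact Finset.sum_le_sum fun i _ => mul_le_mul_of_nonneg_right (hj i) (mul_self_nonneg _)
  · have h : (K ^ m).trace = ∑ i, hK.1.eigenvalues i ^ m := by
      conv_lhs => rw [hspec, ← map_pow, Unitary.conjStarAlgAut_apply]
      rw [Matrix.trace_mul_comm, ← mul_assoc, Unitary.star_mul_self_of_mem U.2, one_mul,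
        Matrix.diagonal_pow, Matrix.trace_diagonal]
      simp
    rw [h]
    exact Finset.single_le_sum (f := fun i => hK.1.eigenvalues i ^ m)
      (fun i _ => pow_nonneg (hnn i) m) (Finset.mem_univ j)

open Matrix in
/-- If the quadratic form of a nonnegative matrix `K` is at most `β` on nonnegative vectors, then
`u = (z - K)⁻¹ 1` exists for `z > β` and is positive, by the maximum principle, so that `z` bounds
the growth of the powers of `K`. The matrix need not be symmetric. -/
lemma exists_pos_superharmonic {K : Matrix α α ℝ} (hK : ∀ a b, 0 ≤ K a b) {β z : ℝ}
    (hβ : 0 ≤ β) (hz : β < z)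
    (hquad : ∀ v : α → ℝ, (∀ a, 0 ≤ v a) → v ⬝ᵥ K *ᵥ v ≤ β * (v ⬝ᵥ v)) :
    ∃ u : α → ℝ, (∀ a, 0 < u a) ∧ ∀ a, ∑ b, K a b * u b ≤ z * u a := by
  have hz0 : 0 < z := hβ.trans_lt hz
  have hself : ∀ v : α → ℝ, v ⬝ᵥ v ≤ 0 → v = 0 := fun v hv =>
    dotProduct_self_eq_zero.1 (le_antisymm hv (Finset.sum_nonneg fun i _ => mul_self_nonneg _))
  have hinj : Function.Injective ((z • (1 : Matrix α α ℝ) - K).mulVecLin) := by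
    rw [← LinearMap.ker_eq_bot, LinearMap.ker_eq_bot']
    intro v hv
    rw [Matrix.mulVecLin_apply, Matrix.sub_mulVec, Matrix.smul_mulVec, Matrix.one_mulVec,
      sub_eq_zero] at hv
    have h1 : z * (v ⬝ᵥ v) = v ⬝ᵥ K *ᵥ v := by rw [← hv, dotProduct_smul, smul_eq_mul]
    have h2 : v ⬝ᵥ K *ᵥ v ≤ (fun a => |v a|) ⬝ᵥ K *ᵥ (fun a => |v a|) := by
      simp only [dotProduct, Matrix.mulVec, Finset.mul_sum]
      refine Finset.sum_le_sum fun a _ => Finset.sum_le_sum fun b _ => ?_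
      calc v a * (K a b * v b) ≤ |v a * (K a b * v b)| := le_abs_self _
        _ = |v a| * (K a b * |v b|) := by rw [abs_mul, abs_mul, abs_of_nonneg (hK a b)]
    have h3 : (fun a => |v a|) ⬝ᵥ (fun a => |v a|) = v ⬝ᵥ v := by
      simp only [dotProduct, abs_mul_abs_self]
    have h4 := hquad (fun a => |v a|) fun a => abs_nonneg _
    rw [h3] at h4
    refine hself v ?_
    by_contra hpos
    push Not at hpos
    nlinarith [mul_pos (sub_pos.2 hz) hpos]
  obtain ⟨u, hu⟩ := (LinearMap.injective_iff_surjective.1 hinj) (fun _ => (1 : ℝ))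
  rw [Matrix.mulVecLin_apply, Matrix.sub_mulVec, Matrix.smul_mulVec, Matrix.one_mulVec] at hu
  have hu' : ∀ a, z * u a - ∑ b, K a b * u b = 1 := fun a => congrFun hu a
  -- The negative part of `u` vanishes.
  set w : α → ℝ := fun a => max (-u a) 0 with hw
  have hw0 : ∀ a, 0 ≤ w a := fun a => le_max_right _ _
  have hwu : ∀ a, -w a ≤ u a := fun a => by
    have : -u a ≤ w a := le_max_left _ _
    linarith
  have hmul : ∀ a, w a * u a = -(w a * w a) := fun a => by
    rcases le_total (-u a) 0 with h | h
    · simp [hw, max_eq_right h]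
    · simp [hw, max_eq_left h]
  have hw_zero : w = 0 := by
    refine hself w ?_
    have hq := hquad w hw0
    have hkey : 0 ≤ -(z * (w ⬝ᵥ w)) + w ⬝ᵥ K *ᵥ w := by
      simp only [dotProduct, Matrix.mulVec, Finset.mul_sum]
      rw [← Finset.sum_neg_distrib, ← Finset.sum_add_distrib]
      refine Finset.sum_nonneg fun a _ => ?_
      have h1 : 0 ≤ w a * (z * u a - ∑ b, K a b * u b) := by rw [hu', mul_one]; exact hw0 a
      have h2 : -∑ b, w a * (K a b * w b) ≤ w a * ∑ b, K a b * u b := by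
        rw [Finset.mul_sum, ← Finset.sum_neg_distrib]
        refine Finset.sum_le_sum fun b _ => ?_
        rw [← mul_neg, ← mul_neg]
        exact mul_le_mul_of_nonneg_left (mul_le_mul_of_nonneg_left (hwu b) (hK a b)) (hw0 a)
      have h3 : w a * (z * u a) = -(z * (w a * w a)) := by
        rw [← mul_neg, ← hmul]; ring
      rw [mul_sub, h3] at h1
      linarith
    by_contra hpos
    push Not at hpos
    nlinarith [mul_pos (sub_pos.2 hz) hpos]
  have hu0 : ∀ a, 0 ≤ u a := fun a => by simpa [hw_zero] using hwu a
  refine ⟨u, fun a => ?_, fun a => by linarith [hu' a]⟩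
  have : 0 ≤ ∑ b, K a b * u b := Finset.sum_nonneg fun b _ => mul_nonneg (hK a b) (hu0 b)
  exact pos_of_mul_pos_right (by linarith [hu' a]) hz0.le

end Spectral

/-! ### Tilted kernels and the pairwise converse bound -/

section Converse

variable {r : ℕ}

/-- Summing out the source letters leaves a partition function of the output letters. -/
lemma sum_sum_prod_eq_partitionFn {n : ℕ} (σ : Equiv.Perm (Fin n))
    (g : Fin r → Fin r → Fin r → ℝ) :
    ∑ x : Fin n → Fin r, ∑ z : Fin n → Fin r, ∏ i, g (x i) (z i) (z (σ i))
      = partitionFn σ (fun b b' => ∑ a, g a b b') := by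
  rw [Finset.sum_comm]
  unfold partitionFn
  refine Finset.sum_congr rfl fun z _ => ?_
  rw [Finset.prod_univ_sum, Fintype.piFinset_univ]

/-- The kernel on the output alphabet of the Chernoff sum with exponents `1/2 + s` and `1/2 - s`:
`∑ₐ M(a,b)^(1/2+s) M(a,b')^(1/2-s)`. -/
noncomputable def tiltedKernel (M : Fin r → Fin r → ℝ) (s : ℝ) : Matrix (Fin r) (Fin r) ℝ :=
  fun b b' => ∑ a, M a b ^ (1 / 2 + s) * M a b' ^ (1 / 2 - s)

lemma tiltedKernel_nonneg {M : Fin r → Fin r → ℝ} (hM : ∀ a b, 0 ≤ M a b) (s : ℝ)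
    (b b' : Fin r) : 0 ≤ tiltedKernel M s b b' :=
  Finset.sum_nonneg fun _ _ =>
    mul_nonneg (Real.rpow_nonneg (hM _ _) _) (Real.rpow_nonneg (hM _ _) _)

lemma tiltedKernel_zero (M : Fin r → Fin r → ℝ) :
    tiltedKernel M 0 = (Matrix.of fun a b => √(M a b)).conjTranspose *
      Matrix.of fun a b => √(M a b) := by
  ext b b'
  simp [tiltedKernel, Matrix.mul_apply, Real.sqrt_eq_rpow]

lemma rpow_half_mul_eq_exp {m m' : ℝ} (hm : 0 < m) (hm' : 0 < m') (s : ℝ) :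
    m ^ (1 / 2 + s) * m' ^ (1 / 2 - s)
      = Real.exp ((Real.log m + Real.log m') / 2 + s * (Real.log m - Real.log m')) := by
  rw [Real.rpow_def_of_pos hm, Real.rpow_def_of_pos hm', ← Real.exp_add]
  ring_nf

lemma tilted_add_le {m m' s B : ℝ} (hm : 0 ≤ m) (hm' : 0 ≤ m') (hs : |s| < 1 / 2)
    (hB : 0 < m → 0 < m' → |Real.log m - Real.log m'| ≤ B) :
    m ^ (1 / 2 + s) * m' ^ (1 / 2 - s) + m' ^ (1 / 2 + s) * m ^ (1 / 2 - s)
      ≤ 2 * (Real.exp (s ^ 2 * B ^ 2 / 2) * (m ^ (1 / 2 + (0 : ℝ)) * m' ^ (1 / 2 - (0 : ℝ)))) := by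
  obtain ⟨hs1, hs2⟩ := abs_lt.1 hs
  rcases hm.eq_or_lt with rfl | hm
  · rw [Real.zero_rpow (by linarith), Real.zero_rpow (by linarith), Real.zero_rpow (by norm_num)]
    simp
  rcases hm'.eq_or_lt with rfl | hm'
  · rw [Real.zero_rpow (by linarith), Real.zero_rpow (by linarith), Real.zero_rpow (by norm_num)]
    simp
  rw [rpow_half_mul_eq_exp hm hm', rpow_half_mul_eq_exp hm' hm, rpow_half_mul_eq_exp hm hm']
  set d := Real.log m - Real.log m' with hd
  have hd' : Real.log m' - Real.log m = -d := by rw [hd]; ring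
  have hcosh : Real.cosh (s * d) ≤ Real.exp (s ^ 2 * B ^ 2 / 2) := by
    refine (Real.cosh_le_exp_half_sq _).trans (Real.exp_le_exp.2 ?_)
    have : d ^ 2 ≤ B ^ 2 := sq_le_sq' (by linarith [(abs_le.1 (hB hm hm')).1])
      (abs_le.1 (hB hm hm')).2
    have := mul_le_mul_of_nonneg_left this (sq_nonneg s)
    rw [mul_pow]
    linarith
  rw [Real.cosh_eq] at hcosh
  rw [hd', add_comm (Real.log m') (Real.log m), zero_mul, add_zero, Real.exp_add, Real.exp_add,
    mul_neg]
  have := mul_le_mul_of_nonneg_left hcosh (Real.exp_pos ((Real.log m + Real.log m') / 2)).le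
  linarith

open Matrix in
/-- Tilting increases the quadratic form only to second order: exchanging the two output letters
changes the sign of the tilt, so that only the even part `cosh` of the tilt contributes. -/
lemma tiltedKernel_quad_le {M : Fin r → Fin r → ℝ} (hM : ∀ a b, 0 ≤ M a b) {s B : ℝ}
    (hs : |s| < 1 / 2)
    (hB : ∀ a b b', 0 < M a b → 0 < M a b' → |Real.log (M a b) - Real.log (M a b')| ≤ B)
    (v : Fin r → ℝ) (hv : ∀ b, 0 ≤ v b) :
    v ⬝ᵥ tiltedKernel M s *ᵥ v
      ≤ Real.exp (s ^ 2 * B ^ 2 / 2) * (v ⬝ᵥ tiltedKernel M 0 *ᵥ v) := by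
  have hform : ∀ K : Matrix (Fin r) (Fin r) ℝ, v ⬝ᵥ K *ᵥ v = ∑ b, ∑ b', v b * v b' * K b b' := by
    intro K
    simp only [dotProduct, Matrix.mulVec, Finset.mul_sum]
    exact Finset.sum_congr rfl fun b _ => Finset.sum_congr rfl fun b' _ => by ring
  have hswap : v ⬝ᵥ tiltedKernel M s *ᵥ v = ∑ b, ∑ b', v b * v b' * tiltedKernel M s b' b := by
    rw [hform, Finset.sum_comm]
    exact Finset.sum_congr rfl fun b _ => Finset.sum_congr rfl fun b' _ => by ring
  have htwo : 2 * (v ⬝ᵥ tiltedKernel M s *ᵥ v)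
      ≤ 2 * (Real.exp (s ^ 2 * B ^ 2 / 2) * (v ⬝ᵥ tiltedKernel M 0 *ᵥ v)) := by
    rw [two_mul]
    nth_rewrite 2 [hswap]
    rw [hform, hform, ← Finset.sum_add_distrib, Finset.mul_sum, Finset.mul_sum]
    refine Finset.sum_le_sum fun b _ => ?_
    rw [← Finset.sum_add_distrib, Finset.mul_sum, Finset.mul_sum]
    refine Finset.sum_le_sum fun b' _ => ?_
    have h : tiltedKernel M s b b' + tiltedKernel M s b' b
        ≤ 2 * (Real.exp (s ^ 2 * B ^ 2 / 2) * tiltedKernel M 0 b b') := by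
      simp only [tiltedKernel]
      rw [← Finset.sum_add_distrib, Finset.mul_sum, Finset.mul_sum]
      exact Finset.sum_le_sum fun a _ => tilted_add_le (hM a b) (hM a b') hs (hB a b b')
    have := mul_le_mul_of_nonneg_left h (mul_nonneg (hv b) (hv b'))
    linarith
  linarith

/-- A minimum is at least the geometric mean times `exp (-T / 2)`, up to a correction that takes
over where the logarithms differ by more than `T`. -/
lemma min_ge_tilted {A B s T : ℝ} (hA : 0 ≤ A) (hB : 0 ≤ B) (hs : 0 < s) :
    Real.exp (-(T / 2)) * (A ^ (1 / 2 + (0 : ℝ)) * B ^ (1 / 2 - (0 : ℝ))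
      - Real.exp (-(s * T)) * (A ^ (1 / 2 + s) * B ^ (1 / 2 - s)
        + A ^ (1 / 2 + -s) * B ^ (1 / 2 - -s))) ≤ min A B := by
  have hnn : ∀ t : ℝ, 0 ≤ A ^ (1 / 2 + t) * B ^ (1 / 2 - t) := fun t =>
    mul_nonneg (Real.rpow_nonneg hA _) (Real.rpow_nonneg hB _)
  have hc := mul_nonneg (Real.exp_pos (-(s * T))).le (add_nonneg (hnn s) (hnn (-s)))
  have hcase : A ^ (1 / 2 + (0 : ℝ)) * B ^ (1 / 2 - (0 : ℝ)) ≤ Real.exp (-(s * T)) *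
      (A ^ (1 / 2 + s) * B ^ (1 / 2 - s) + A ^ (1 / 2 + -s) * B ^ (1 / 2 - -s)) →
      Real.exp (-(T / 2)) * (A ^ (1 / 2 + (0 : ℝ)) * B ^ (1 / 2 - (0 : ℝ))
      - Real.exp (-(s * T)) * (A ^ (1 / 2 + s) * B ^ (1 / 2 - s)
        + A ^ (1 / 2 + -s) * B ^ (1 / 2 - -s))) ≤ min A B := fun h =>
    (mul_nonpos_of_nonneg_of_nonpos (Real.exp_pos _).le (sub_nonpos.2 h)).trans (le_min hA hB)
  rcases hA.eq_or_lt with rfl | hA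
  · refine hcase (le_trans (le_of_eq ?_) hc)
    rw [Real.zero_rpow (by norm_num), zero_mul]
  rcases hB.eq_or_lt with rfl | hB
  · refine hcase (le_trans (le_of_eq ?_) hc)
    rw [Real.zero_rpow (by norm_num), mul_zero]
  rcases le_or_gt |Real.log A - Real.log B| T with h | h
  · refine (mul_le_mul_of_nonneg_left (sub_le_self _ hc) (Real.exp_pos _).le).trans ?_
    rw [rpow_half_mul_eq_exp hA hB, ← Real.exp_add]
    obtain ⟨h1, h2⟩ := abs_le.1 h
    refine le_min ?_ ?_
    · conv_rhs => rw [← Real.exp_log hA]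
      exact Real.exp_le_exp.2 (by linarith)
    · conv_rhs => rw [← Real.exp_log hB]
      exact Real.exp_le_exp.2 (by linarith)
  · refine hcase ?_
    rw [mul_add]
    have h1 := mul_nonneg (Real.exp_pos (-(s * T))).le (hnn s)
    have h2 := mul_nonneg (Real.exp_pos (-(s * T))).le (hnn (-s))
    rw [rpow_half_mul_eq_exp hA hB] at h1 h2 ⊢
    rw [rpow_half_mul_eq_exp hA hB, rpow_half_mul_eq_exp hA hB]
    rcases lt_abs.1 h with h' | h'
    · have := mul_lt_mul_of_pos_left h' hs
      refine le_trans ?_ (le_add_of_nonneg_right h2)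
      rw [← Real.exp_add]
      exact Real.exp_le_exp.2 (by linarith)
    · have := mul_lt_mul_of_pos_left h' hs
      refine le_trans ?_ (le_add_of_nonneg_left h1)
      rw [← Real.exp_add]
      exact Real.exp_le_exp.2 (by linarith)

open Matrix in
/-- Pairwise converse: the overlap of the laws under two delays whose relative shift has few cycles
is at least `ρ ^ n`, up to an arbitrarily small exponential loss. -/
lemma exists_overlap_ge (hr : 0 < r) {M : Fin r → Fin r → ℝ} (hM : ∀ a b, 0 ≤ M a b) {ρ : ℝ}
    (hρ : 0 < ρ) (hquad : ∀ v : Fin r → ℝ, v ⬝ᵥ tiltedKernel M 0 *ᵥ v ≤ ρ * (v ⬝ᵥ v))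
    (htr : ∀ m, ρ ^ m ≤ (tiltedKernel M 0 ^ m).trace) {δ : ℝ} (hδ : 0 < δ) :
    ∃ η > 0, ∃ N : ℕ, ∀ n ≥ N, ∀ σ : Equiv.Perm (Fin n), (numCycles σ : ℝ) ≤ η * n →
      Real.exp (-δ * n) * ρ ^ n ≤ ∑ x : Fin n → Fin r, ∑ z : Fin n → Fin r,
        min (∏ i, M (x i) (z i)) (∏ i, M (x i) (z (σ i))) := by
  obtain ⟨B, hB1, hB⟩ : ∃ B : ℝ, 1 ≤ B ∧ ∀ a b b', 0 < M a b → 0 < M a b' →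
      |Real.log (M a b) - Real.log (M a b')| ≤ B := by
    refine ⟨1 + ∑ a, ∑ b, ∑ b', |Real.log (M a b) - Real.log (M a b')|, ?_, ?_⟩
    · exact le_add_of_nonneg_right (Finset.sum_nonneg fun _ _ => Finset.sum_nonneg fun _ _ =>
        Finset.sum_nonneg fun _ _ => abs_nonneg _)
    · intro a b b' _ _
      refine le_trans ?_ (le_add_of_nonneg_left zero_le_one)
      refine (Finset.single_le_sum (f := fun b' => |Real.log (M a b) - Real.log (M a b')|)
        (fun _ _ => abs_nonneg _) (Finset.mem_univ b')).trans ?_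
      refine (Finset.single_le_sum (f := fun b => ∑ b', |Real.log (M a b) - Real.log (M a b')|)
        (fun _ _ => Finset.sum_nonneg fun _ _ => abs_nonneg _) (Finset.mem_univ b)).trans ?_
      exact Finset.single_le_sum
        (f := fun a => ∑ b, ∑ b', |Real.log (M a b) - Real.log (M a b')|)
        (fun _ _ => Finset.sum_nonneg fun _ _ => Finset.sum_nonneg fun _ _ => abs_nonneg _)
        (Finset.mem_univ a)
  have hB2 : 0 < B ^ 2 := by positivity
  -- The tilt is small enough for its second-order cost `s²B²` to be at most half its gain `sδ`.
  set s : ℝ := min (1 / 4) (δ / (2 * B ^ 2)) with hs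
  have hs0 : 0 < s := lt_min (by norm_num) (by positivity)
  have hs1 : s < 1 / 2 := (min_le_left _ _).trans_lt (by norm_num)
  have hsB : s ^ 2 * B ^ 2 ≤ s * δ / 2 := by
    have h : s * (2 * B ^ 2) ≤ δ := (le_div_iff₀ (by positivity)).1 (min_le_right _ _)
    nlinarith
  set θ : ℝ := s * δ / 4 with hθ
  have hθ0 : 0 < θ := by positivity
  have hlog : 0 ≤ Real.log r := Real.log_natCast_nonneg r
  have hr' : (0 : ℝ) < r := by exact_mod_cast hr
  refine ⟨θ / (Real.log r + 1), by positivity, ⌈3 / θ + 2 / δ⌉₊, fun n hn σ hσ => ?_⟩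
  have hn' : 3 / θ + 2 / δ ≤ n := Nat.ceil_le.1 hn
  have hnθ : 3 ≤ θ * n := by
    have h : 3 / θ ≤ n := le_trans (le_add_of_nonneg_right (by positivity)) hn'
    rw [div_le_iff₀ hθ0] at h; linarith
  have hnδ : 2 ≤ δ * n := by
    have h : 2 / δ ≤ n := le_trans (le_add_of_nonneg_left (by positivity)) hn'
    rw [div_le_iff₀ hδ] at h; linarith
  have hcyc : (r : ℝ) ^ numCycles σ ≤ Real.exp (θ * n) := by
    rw [← Real.exp_log (pow_pos hr' _), Real.log_pow]
    refine Real.exp_le_exp.2 ?_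
    calc (numCycles σ : ℝ) * Real.log r ≤ θ / (Real.log r + 1) * n * (Real.log r + 1) :=
          mul_le_mul hσ (by linarith) hlog (by positivity)
      _ = θ * n := by field_simp
  set z : ℝ := ρ * Real.exp (s ^ 2 * B ^ 2) with hz
  have hpart : ∀ t, |t| = s →
      partitionFn σ (tiltedKernel M t) ≤ Real.exp (3 * (θ * n)) * ρ ^ n := by
    intro t ht
    have ht2 : t ^ 2 = s ^ 2 := by rw [← sq_abs, ht]
    obtain ⟨u, hu, hKu⟩ := exists_pos_superharmonic (tiltedKernel_nonneg hM t)
      (β := Real.exp (t ^ 2 * B ^ 2 / 2) * ρ) (z := z) (by positivity)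
      (by
        rw [hz, ht2, mul_comm]
        exact mul_lt_mul_of_pos_left (Real.exp_lt_exp.2 (half_lt_self (by positivity))) hρ)
      (fun v hv => (tiltedKernel_quad_le hM (ht.trans_lt hs1) hB v hv).trans (by
        rw [mul_assoc]
        exact mul_le_mul_of_nonneg_left (hquad v) (Real.exp_pos _).le))
    refine (partitionFn_le σ (tiltedKernel_nonneg hM t) hu (by positivity) hKu).trans ?_
    rw [Fintype.card_fin]
    calc (r : ℝ) ^ numCycles σ * z ^ n ≤ Real.exp (θ * n) * (Real.exp (2 * (θ * n)) * ρ ^ n) := by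
          refine mul_le_mul hcyc ?_ (by positivity) (by positivity)
          rw [hz, mul_pow, mul_comm, ← Real.exp_nat_mul]
          refine mul_le_mul_of_nonneg_right (Real.exp_le_exp.2 ?_) (by positivity)
          have := mul_le_mul_of_nonneg_left hsB (Nat.cast_nonneg (α := ℝ) n)
          rw [hθ]; linarith
      _ = _ := by rw [← mul_assoc, ← Real.exp_add]; ring_nf
  have hprod : ∀ t, ∑ x : Fin n → Fin r, ∑ z : Fin n → Fin r,
      (∏ i, M (x i) (z i)) ^ (1 / 2 + t) * (∏ i, M (x i) (z (σ i))) ^ (1 / 2 - t)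
        = partitionFn σ (tiltedKernel M t) := by
    intro t
    have h := sum_sum_prod_eq_partitionFn σ
      fun a b b' => M a b ^ (1 / 2 + t) * M a b' ^ (1 / 2 - t)
    refine Eq.trans ?_ h
    refine Finset.sum_congr rfl fun x _ => Finset.sum_congr rfl fun z _ => ?_
    rw [Finset.prod_mul_distrib, Real.finsetProd_rpow _ _ fun i _ => hM _ _,
      Real.finsetProd_rpow _ _ fun i _ => hM _ _]
  have hnn : ∀ (x z : Fin n → Fin r), 0 ≤ ∏ i, M (x i) (z i) := fun x z =>
    Finset.prod_nonneg fun i _ => hM _ _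
  have hlow : Real.exp (-(δ * n / 2)) * (partitionFn σ (tiltedKernel M 0)
      - Real.exp (-(s * (δ * n))) * (partitionFn σ (tiltedKernel M s)
        + partitionFn σ (tiltedKernel M (-s)))) ≤ ∑ x : Fin n → Fin r, ∑ z : Fin n → Fin r,
        min (∏ i, M (x i) (z i)) (∏ i, M (x i) (z (σ i))) := by
    rw [← hprod, ← hprod, ← hprod]
    simp only [← Finset.sum_add_distrib, Finset.mul_sum, ← Finset.sum_sub_distrib]
    refine Finset.sum_le_sum fun x _ => Finset.sum_le_sum fun z _ => ?_
    exact min_ge_tilted (hnn x z) (hnn x (z ∘ σ)) hs0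
  refine le_trans ?_ hlow
  have h0 := le_partitionFn σ hρ.le htr
  have hp := hpart s (abs_of_pos hs0)
  have hm := hpart (-s) (by rw [abs_neg, abs_of_pos hs0])
  have hexp : Real.exp (-(s * (δ * n))) * Real.exp (3 * (θ * n)) ≤ 1 / 4 := by
    rw [← Real.exp_add, show -(s * (δ * n)) + 3 * (θ * n) = -(θ * n) by rw [hθ]; ring,
      Real.exp_neg, one_div]
    exact inv_anti₀ (by norm_num) (by linarith [Real.add_one_le_exp (θ * n)])
  have hexp2 : Real.exp (-(δ * n / 2)) ≤ 1 / 2 := by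
    rw [Real.exp_neg, one_div]
    exact inv_anti₀ (by norm_num) (by linarith [Real.add_one_le_exp (δ * n / 2)])
  have hρn : 0 < ρ ^ n := pow_pos hρ n
  have hsub : ρ ^ n / 2 ≤ partitionFn σ (tiltedKernel M 0)
      - Real.exp (-(s * (δ * n))) * (partitionFn σ (tiltedKernel M s)
        + partitionFn σ (tiltedKernel M (-s))) := by
    have h1 := mul_le_mul_of_nonneg_left (add_le_add hp hm) (Real.exp_pos (-(s * (δ * n)))).le
    have h2 := mul_le_mul_of_nonneg_right hexp hρn.le
    linarith
  have hsplit : Real.exp (-δ * n) = Real.exp (-(δ * n / 2)) * Real.exp (-(δ * n / 2)) := by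
    rw [← Real.exp_add]; ring_nf
  rw [hsplit, mul_assoc]
  refine mul_le_mul_of_nonneg_left (le_trans ?_ hsub) (Real.exp_pos _).le
  linarith [mul_le_mul_of_nonneg_right hexp2 hρn.le]

end Converse

/-! ### Empirical distributions and mutual information -/

section Types

variable {r : ℕ}

lemma mutualInfo_mul_log_two {q : Fin r → Fin r → ℝ} (hq : ∀ a b, 0 ≤ q a b) :
    mutualInfo q * Real.log 2 = (∑ a, ∑ b, q a b * Real.log (q a b))
      - (∑ a, (∑ b, q a b) * Real.log (∑ b, q a b))
      - ∑ b, (∑ a, q a b) * Real.log (∑ a, q a b) := by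
  have hcomm : ∑ b, (∑ a, q a b) * Real.log (∑ a, q a b)
      = ∑ a, ∑ b, q a b * Real.log (∑ a', q a' b) := by
    rw [Finset.sum_comm]
    simp_rw [Finset.sum_mul]
  rw [hcomm, mutualInfo, Finset.sum_mul, ← Finset.sum_sub_distrib, ← Finset.sum_sub_distrib]
  refine Finset.sum_congr rfl fun a _ => ?_
  rw [Finset.sum_mul, Finset.sum_mul, ← Finset.sum_sub_distrib, ← Finset.sum_sub_distrib]
  refine Finset.sum_congr rfl fun b _ => ?_
  rcases (hq a b).eq_or_lt with h | h
  · simp [← h]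
  have hX : 0 < ∑ b', q a b' :=
    h.trans_le (Finset.single_le_sum (fun b' _ => hq a b') (Finset.mem_univ b))
  have hY : 0 < ∑ a', q a' b :=
    h.trans_le (Finset.single_le_sum (f := fun a' => q a' b) (fun a' _ => hq a' b)
      (Finset.mem_univ a))
  have h2 : Real.log 2 ≠ 0 := (Real.log_pos one_lt_two).ne'
  rw [Real.logb, mul_assoc, div_mul_cancel₀ _ h2, Real.log_div h.ne' (mul_pos hX hY).ne',
    Real.log_mul hX.ne' hY.ne']
  ring

open Matrix in
/-- Cauchy–Schwarz for the matrix `√M`, whose squared operator norm is at most `ρ`. -/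
lemma sum_sqrt_le {M : Fin r → Fin r → ℝ} {ρ : ℝ}
    (hquad : ∀ v : Fin r → ℝ, v ⬝ᵥ tiltedKernel M 0 *ᵥ v ≤ ρ * (v ⬝ᵥ v))
    {p p' : Fin r → ℝ} (hp : ∀ a, 0 ≤ p a) (hp' : ∀ b, 0 ≤ p' b) (hp1 : ∑ a, p a = 1)
    (hp1' : ∑ b, p' b = 1) :
    ∑ a, ∑ b, √(M a b) * √(p a) * √(p' b) ≤ √ρ := by
  set S : Matrix (Fin r) (Fin r) ℝ := Matrix.of fun a b => √(M a b) with hS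
  set w : Fin r → ℝ := fun b => √(p' b) with hw
  have hww : w ⬝ᵥ w = 1 := by
    simp only [dotProduct, hw, Real.mul_self_sqrt (hp' _), hp1']
  have hSw : ∑ a, (S *ᵥ w) a ^ 2 ≤ ρ := by
    have h := hquad w
    rw [tiltedKernel_zero, ← hS, hww, mul_one, Matrix.conjTranspose_eq_transpose_of_trivial,
      ← Matrix.mulVec_mulVec, Matrix.dotProduct_mulVec, Matrix.vecMul_transpose] at h
    simpa only [dotProduct, sq] using h
  calc ∑ a, ∑ b, √(M a b) * √(p a) * √(p' b) = ∑ a, √(p a) * (S *ᵥ w) a := by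
        refine Finset.sum_congr rfl fun a _ => ?_
        simp only [Matrix.mulVec, dotProduct, Finset.mul_sum]
        exact Finset.sum_congr rfl fun b _ => by simp only [hS, Matrix.of_apply, hw]; ring
    _ ≤ √(∑ a, √(p a) ^ 2) * √(∑ a, (S *ᵥ w) a ^ 2) := Real.sum_mul_le_sqrt_mul_sqrt _ _ _
    _ ≤ √ρ := by
        simp only [Real.sq_sqrt (hp _), hp1, Real.sqrt_one, one_mul]
        exact Real.sqrt_le_sqrt hSw

open Matrix in
/-- The variational bound `D(q ‖ M) + I(q) ≥ -log ρ`, with the terms of `D` and `I` expanded. -/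
lemma sum_mul_log_le {M q : Fin r → Fin r → ℝ} {ρ : ℝ} (hρ : 0 < ρ)
    (hquad : ∀ v : Fin r → ℝ, v ⬝ᵥ tiltedKernel M 0 *ᵥ v ≤ ρ * (v ⬝ᵥ v))
    (hq : ∀ a b, 0 ≤ q a b) (hq1 : ∑ a, ∑ b, q a b = 1) (hqM : ∀ a b, 0 < q a b → 0 < M a b) :
    ∑ a, ∑ b, q a b * Real.log (M a b) ≤ Real.log ρ
      + 2 * (∑ a, ∑ b, q a b * Real.log (q a b))
      - (∑ a, (∑ b, q a b) * Real.log (∑ b, q a b))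
      - ∑ b, (∑ a, q a b) * Real.log (∑ a, q a b) := by
  set qX : Fin r → ℝ := fun a => ∑ b, q a b with hqX
  set qY : Fin r → ℝ := fun b => ∑ a, q a b with hqY
  have hX0 : ∀ a, 0 ≤ qX a := fun a => Finset.sum_nonneg fun b _ => hq a b
  have hY0 : ∀ b, 0 ≤ qY b := fun b => Finset.sum_nonneg fun a _ => hq a b
  have hY1 : ∑ b, qY b = 1 := by rw [hqY, Finset.sum_comm, hq1]
  have hsq := sum_sqrt_le hquad hX0 hY0 hq1 hY1
  have hcX : ∑ a, qX a * Real.log (qX a) = ∑ a, ∑ b, q a b * Real.log (qX a) := by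
    simp_rw [hqX, Finset.sum_mul]
  have hcY : ∑ b, qY b * Real.log (qY b) = ∑ a, ∑ b, q a b * Real.log (qY b) := by
    rw [Finset.sum_comm]
    simp_rw [hqY, Finset.sum_mul]
  have hcρ : Real.log ρ = ∑ a, ∑ b, q a b * Real.log ρ := by
    simp_rw [← Finset.sum_mul]
    rw [hq1, one_mul]
  have hρs : 0 < √ρ := Real.sqrt_pos.2 hρ
  -- `log t ≤ t - 1` at `t = √(M qX qY / ρ) / q`, summed against `q`.
  have hterm : ∀ a b, q a b * (Real.log (M a b) + Real.log (qX a) + Real.log (qY b)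
      - 2 * Real.log (q a b) - Real.log ρ)
      ≤ 2 * (√(M a b) * √(qX a) * √(qY b) / √ρ - q a b) := by
    intro a b
    rcases (hq a b).eq_or_lt with h | h
    · rw [← h, zero_mul, sub_zero]
      positivity
    have hX : 0 < qX a :=
      h.trans_le (Finset.single_le_sum (fun b' _ => hq a b') (Finset.mem_univ b))
    have hY : 0 < qY b :=
      h.trans_le (Finset.single_le_sum (f := fun a' => q a' b) (fun a' _ => hq a' b)
        (Finset.mem_univ a))
    have hM := hqM a b h
    have hM' := Real.sqrt_pos.2 hM
    have hX' := Real.sqrt_pos.2 hX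
    have hY' := Real.sqrt_pos.2 hY
    have hl := Real.log_le_sub_one_of_pos
      (show 0 < √(M a b) * √(qX a) * √(qY b) / (√ρ * q a b) by positivity)
    rw [Real.log_div (by positivity) (by positivity), Real.log_mul (by positivity) hY'.ne',
      Real.log_mul hM'.ne' hX'.ne', Real.log_mul hρs.ne' h.ne', Real.log_sqrt hM.le,
      Real.log_sqrt hX.le, Real.log_sqrt hY.le, Real.log_sqrt hρ.le] at hl
    have hl' := mul_le_mul_of_nonneg_left hl h.le
    have he : q a b * (√(M a b) * √(qX a) * √(qY b) / (√ρ * q a b) - 1)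
        = √(M a b) * √(qX a) * √(qY b) / √ρ - q a b := by
      field_simp
    rw [he] at hl'
    linarith
  have hsum := Finset.sum_le_sum fun a (_ : a ∈ Finset.univ) =>
    Finset.sum_le_sum fun b (_ : b ∈ Finset.univ) => hterm a b
  have hrhs : ∑ a, ∑ b, 2 * (√(M a b) * √(qX a) * √(qY b) / √ρ - q a b) ≤ 0 := by
    simp_rw [← Finset.mul_sum, Finset.sum_sub_distrib, ← Finset.sum_div]
    rw [hq1]
    have := (div_le_one hρs).2 hsq
    linarith
  have hlhs : ∑ a, ∑ b, q a b * (Real.log (M a b) + Real.log (qX a) + Real.log (qY b)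
      - 2 * Real.log (q a b) - Real.log ρ) = (∑ a, ∑ b, q a b * Real.log (M a b))
      + (∑ a, ∑ b, q a b * Real.log (qX a)) + (∑ a, ∑ b, q a b * Real.log (qY b))
      - 2 * (∑ a, ∑ b, q a b * Real.log (q a b)) - ∑ a, ∑ b, q a b * Real.log ρ := by
    simp only [Finset.mul_sum, ← Finset.sum_add_distrib, ← Finset.sum_sub_distrib]
    exact Finset.sum_congr rfl fun a _ => Finset.sum_congr rfl fun b _ => by ring
  rw [hlhs, ← hcX, ← hcY, ← hcρ] at hsum
  linarith

lemma empDist_nonneg {n : ℕ} (x z : Fin n → Fin r) (a b : Fin r) : 0 ≤ empDist x z a b := by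
  unfold empDist; positivity

lemma empDist_pos {n : ℕ} (hn : 0 < n) (x z : Fin n → Fin r) (i : Fin n) :
    0 < empDist x z (x i) (z i) := by
  have : 0 < (Finset.univ.filter fun j => x j = x i ∧ z j = z i).card :=
    Finset.card_pos.2 ⟨i, by simp⟩
  unfold empDist
  positivity

lemma exists_of_empDist_pos {n : ℕ} {x z : Fin n → Fin r} {a b : Fin r}
    (h : 0 < empDist x z a b) : ∃ i, x i = a ∧ z i = b := by
  by_contra hne
  push Not at hne
  have : (Finset.univ.filter fun i => x i = a ∧ z i = b) = ∅ :=
    Finset.filter_eq_empty_iff.2 fun i _ hi => hne i hi.1 hi.2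
  simp [empDist, this] at h

lemma sum_eq_mul_sum_empDist {n : ℕ} (hn : 0 < n) (x z : Fin n → Fin r) (g : Fin r → Fin r → ℝ) :
    ∑ i, g (x i) (z i) = n * ∑ a, ∑ b, empDist x z a b * g a b := by
  have hn' : (n : ℝ) ≠ 0 := by positivity
  have h : ∀ a b, (n : ℝ) * (empDist x z a b * g a b)
      = ∑ i, if x i = a then (if z i = b then g a b else 0) else 0 := by
    intro a b
    rw [empDist, ← mul_assoc, mul_div_cancel₀ _ hn', ← nsmul_eq_mul, ← Finset.sum_const,
      Finset.sum_filter]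
    exact Finset.sum_congr rfl fun i _ => by rw [ite_and]
  simp_rw [Finset.mul_sum, h]
  rw [Finset.sum_congr rfl fun a _ => Finset.sum_comm, Finset.sum_comm]
  refine Finset.sum_congr rfl fun i _ => ?_
  simp

lemma empDist_sum_right {n : ℕ} (x z : Fin n → Fin r) (a : Fin r) :
    ∑ b, empDist x z a b = (∑ i, if x i = a then (1 : ℝ) else 0) / n := by
  simp_rw [empDist, ← Finset.sum_div, Finset.card_filter, ite_and]
  push_cast
  rw [Finset.sum_comm]
  congr 1
  refine Finset.sum_congr rfl fun i _ => ?_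
  split_ifs <;> simp

lemma empDist_sum_left {n : ℕ} (x z : Fin n → Fin r) (b : Fin r) :
    ∑ a, empDist x z a b = (∑ i, if z i = b then (1 : ℝ) else 0) / n := by
  simp_rw [empDist, ← Finset.sum_div, Finset.card_filter, ite_and]
  push_cast
  rw [Finset.sum_comm]
  congr 1
  refine Finset.sum_congr rfl fun i _ => ?_
  simp

lemma empDist_comp_sum_right {n : ℕ} (x z : Fin n → Fin r) (σ : Equiv.Perm (Fin n)) (a : Fin r) :
    ∑ b, empDist x (z ∘ σ) a b = ∑ b, empDist x z a b := by
  rw [empDist_sum_right, empDist_sum_right]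

lemma empDist_comp_sum_left {n : ℕ} (x z : Fin n → Fin r) (σ : Equiv.Perm (Fin n)) (b : Fin r) :
    ∑ a, empDist x (z ∘ σ) a b = ∑ a, empDist x z a b := by
  rw [empDist_sum_left, empDist_sum_left]
  congr 1
  exact Equiv.sum_comp σ fun i => if z i = b then (1 : ℝ) else 0

/-! ### The pairwise bound for the maximum mutual information rule -/

/-- The kernel `∑ₐ q(a,b) q'(a,b') / (qX(a) qY(b))` on output letters that couples two joint types
with the same source marginal: an output `b` is sent to a source letter by `q`, and from there to
an output by `q'`. The summands vanish where a denominator does. -/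
noncomputable def typeWeight (q q' : Fin r → Fin r → ℝ) (a b b' : Fin r) : ℝ :=
  q a b * q' a b' / ((∑ b, q a b) * ∑ a, q a b)

lemma typeWeight_nonneg {q q' : Fin r → Fin r → ℝ} (hq : ∀ a b, 0 ≤ q a b)
    (hq' : ∀ a b, 0 ≤ q' a b) (a b b' : Fin r) : 0 ≤ typeWeight q q' a b b' :=
  div_nonneg (mul_nonneg (hq a b) (hq' a b')) (mul_nonneg
    (Finset.sum_nonneg fun b _ => hq a b) (Finset.sum_nonneg fun a _ => hq a b))

/-- The kernel of `typeWeight` is substochastic, so its partition function only counts cycles. -/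
lemma sum_typeWeight_le {n : ℕ} (σ : Equiv.Perm (Fin n)) {q q' : Fin r → Fin r → ℝ}
    (hq : ∀ a b, 0 ≤ q a b) (hq' : ∀ a b, 0 ≤ q' a b)
    (hX : ∀ a, ∑ b, q' a b = ∑ b, q a b) :
    ∑ x : Fin n → Fin r, ∑ z : Fin n → Fin r, ∏ i, typeWeight q q' (x i) (z i) (z (σ i))
      ≤ (r : ℝ) ^ numCycles σ := by
  rw [sum_sum_prod_eq_partitionFn]
  have h := partitionFn_le σ (K := fun b b' => ∑ a, typeWeight q q' a b b')
    (fun b b' => Finset.sum_nonneg fun a _ => typeWeight_nonneg hq hq' a b b')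
    (u := fun _ => 1) (fun _ => one_pos) (z := 1) zero_le_one ?_
  · simpa using h
  intro b
  simp only [mul_one]
  rw [Finset.sum_comm]
  calc ∑ a, ∑ b', typeWeight q q' a b b' ≤ ∑ a, q a b / ∑ a', q a' b := by
        refine Finset.sum_le_sum fun a _ => ?_
        simp only [typeWeight]
        rw [← Finset.sum_div, ← Finset.mul_sum, hX]
        rcases eq_or_ne (∑ b, q a b) 0 with h0 | h0
        · rw [h0, mul_zero, zero_div]
          exact div_nonneg (hq a b) (Finset.sum_nonneg fun a _ => hq a b)
        · rw [mul_comm (q a b), mul_div_mul_left _ _ h0]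
    _ ≤ 1 := by rw [← Finset.sum_div]; exact div_self_le_one _

open Matrix in
/-- Where the shifted output has at least the empirical mutual information of the true one, the
likelihood is at most `ρ ^ n` times the weight of the pair of joint types that occurs. -/
lemma prod_le_of_mutualInfo_le {n : ℕ} (hn : 0 < n) {M : Fin r → Fin r → ℝ}
    (hM : ∀ a b, 0 ≤ M a b) {ρ : ℝ} (hρ : 0 < ρ)
    (hquad : ∀ v : Fin r → ℝ, v ⬝ᵥ tiltedKernel M 0 *ᵥ v ≤ ρ * (v ⬝ᵥ v))
    (σ : Equiv.Perm (Fin n)) (x z : Fin n → Fin r)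
    (hI : mutualInfo (empDist x z) ≤ mutualInfo (empDist x (z ∘ σ))) :
    ∏ i, M (x i) (z i) ≤ ρ ^ n *
      ∏ i, typeWeight (empDist x z) (empDist x (z ∘ σ)) (x i) (z i) (z (σ i)) := by
  set q := empDist x z with hq
  set q' := empDist x (z ∘ σ) with hq'
  have hq0 : ∀ a b, 0 ≤ q a b := empDist_nonneg x z
  have hq0' : ∀ a b, 0 ≤ q' a b := empDist_nonneg x (z ∘ σ)
  have hqi : ∀ i, 0 < q (x i) (z i) := empDist_pos hn x z
  have hqi' : ∀ i, 0 < q' (x i) (z (σ i)) := empDist_pos hn x (z ∘ σ)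
  by_cases hpos : ∀ i, 0 < M (x i) (z i)
  swap
  · push Not at hpos
    obtain ⟨i, hi⟩ := hpos
    rw [Finset.prod_eq_zero (Finset.mem_univ i) (le_antisymm hi (hM _ _))]
    exact mul_nonneg (pow_pos hρ n).le
      (Finset.prod_nonneg fun i _ => typeWeight_nonneg hq0 hq0' _ _ _)
  have hXi : ∀ i, 0 < ∑ b, q (x i) b := fun i =>
    (hqi i).trans_le (Finset.single_le_sum (fun b _ => hq0 _ b) (Finset.mem_univ (z i)))
  have hYi : ∀ i, 0 < ∑ a, q a (z i) := fun i =>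
    (hqi i).trans_le (Finset.single_le_sum (f := fun a => q a (z i)) (fun a _ => hq0 a _)
      (Finset.mem_univ (x i)))
  have hwi : ∀ i, 0 < typeWeight q q' (x i) (z i) (z (σ i)) := fun i =>
    div_pos (mul_pos (hqi i) (hqi' i)) (mul_pos (hXi i) (hYi i))
  rw [← Real.log_le_log_iff (Finset.prod_pos fun i _ => hpos i)
    (mul_pos (pow_pos hρ n) (Finset.prod_pos fun i _ => hwi i)),
    Real.log_mul (pow_pos hρ n).ne' (Finset.prod_pos fun i _ => hwi i).ne', Real.log_pow,
    Real.log_prod fun i _ => (hpos i).ne', Real.log_prod fun i _ => (hwi i).ne']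
  have hlog : ∀ i, Real.log (typeWeight q q' (x i) (z i) (z (σ i)))
      = Real.log (q (x i) (z i)) + Real.log (q' (x i) ((z ∘ σ) i))
        - Real.log (∑ b, q (x i) b) - Real.log (∑ a, q a (z i)) := fun i => by
    rw [typeWeight, Real.log_div (mul_pos (hqi i) (hqi' i)).ne' (mul_pos (hXi i) (hYi i)).ne',
      Real.log_mul (hqi i).ne' (hqi' i).ne', Real.log_mul (hXi i).ne' (hYi i).ne',
      Function.comp_apply]
    ring
  simp_rw [hlog, Finset.sum_sub_distrib, Finset.sum_add_distrib]
  rw [sum_eq_mul_sum_empDist hn x z fun a b => Real.log (M a b),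
    sum_eq_mul_sum_empDist hn x z fun a b => Real.log (q a b),
    sum_eq_mul_sum_empDist hn x (z ∘ σ) fun a b => Real.log (q' a b),
    sum_eq_mul_sum_empDist hn x z fun a _ => Real.log (∑ b, q a b),
    sum_eq_mul_sum_empDist hn x z fun _ b => Real.log (∑ a, q a b), ← hq, ← hq']
  have hn' : (n : ℝ) ≠ 0 := by positivity
  have hq1 : ∑ a, ∑ b, q a b = 1 := by
    have h := sum_eq_mul_sum_empDist hn x z fun _ _ => (1 : ℝ)
    simp only [mul_one, Finset.sum_const, Finset.card_univ, Fintype.card_fin, nsmul_eq_mul] at h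
    exact (mul_left_cancel₀ hn' (h.symm.trans (mul_one _).symm))
  have hvar := sum_mul_log_le hρ hquad hq0 hq1 fun a b h => by
    obtain ⟨i, rfl, rfl⟩ := exists_of_empDist_pos h
    exact hpos i
  have hI' := mul_le_mul_of_nonneg_right hI (Real.log_pos one_lt_two).le
  rw [mutualInfo_mul_log_two hq0, mutualInfo_mul_log_two hq0'] at hI'
  simp_rw [hq', empDist_comp_sum_right x z σ, empDist_comp_sum_left x z σ, ← hq', ← hq] at hI'
  have hcX : ∑ a, ∑ b, q a b * Real.log (∑ b, q a b)
      = ∑ a, (∑ b, q a b) * Real.log (∑ b, q a b) := by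
    simp_rw [Finset.sum_mul]
  have hcY : ∑ a, ∑ b, q a b * Real.log (∑ a, q a b)
      = ∑ b, (∑ a, q a b) * Real.log (∑ a, q a b) := by
    rw [Finset.sum_comm]
    simp_rw [Finset.sum_mul]
  rw [hcX, hcY, ← mul_add, ← mul_sub, ← mul_sub, ← mul_add]
  exact mul_le_mul_of_nonneg_left (by linarith) (Nat.cast_nonneg n)

open Matrix in
/-- Summing over the at most `(n + 1) ^ (2 r²)` pairs of joint types. -/
lemma sum_mutualInfo_le {n : ℕ} (hn : 0 < n) {M : Fin r → Fin r → ℝ}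
    (hM : ∀ a b, 0 ≤ M a b) {ρ : ℝ} (hρ : 0 < ρ)
    (hquad : ∀ v : Fin r → ℝ, v ⬝ᵥ tiltedKernel M 0 *ᵥ v ≤ ρ * (v ⬝ᵥ v))
    (σ : Equiv.Perm (Fin n)) :
    (∑ x : Fin n → Fin r, ∑ z : Fin n → Fin r,
      if mutualInfo (empDist x z) ≤ mutualInfo (empDist x (z ∘ σ)) then ∏ i, M (x i) (z i) else 0)
      ≤ ((n : ℝ) + 1) ^ (2 * r ^ 2) * (r : ℝ) ^ numCycles σ * ρ ^ n := by
  classical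
  set τ : (Fin n → Fin r) × (Fin n → Fin r) → (Fin r → Fin r → ℝ) × (Fin r → Fin r → ℝ) :=
    fun p => (empDist p.1 p.2, empDist p.1 (p.2 ∘ σ)) with hτ
  set T := Finset.univ.image τ with hT
  have hcard : (T.card : ℝ) ≤ ((n : ℝ) + 1) ^ (2 * r ^ 2) := by
    set F : (Fin r → Fin r → Fin (n + 1)) × (Fin r → Fin r → Fin (n + 1)) →
        (Fin r → Fin r → ℝ) × (Fin r → Fin r → ℝ) :=
      fun c => (fun a b => ((c.1 a b : ℕ) : ℝ) / n, fun a b => ((c.2 a b : ℕ) : ℝ) / n) with hF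
    have hsub : T ⊆ Finset.univ.image F := by
      intro t ht
      obtain ⟨p, -, rfl⟩ := Finset.mem_image.1 ht
      have hlt : ∀ (x z : Fin n → Fin r) (a b : Fin r),
          (Finset.univ.filter fun i => x i = a ∧ z i = b).card < n + 1 := fun x z a b =>
        Nat.lt_succ_of_le ((Finset.card_le_univ _).trans_eq (Fintype.card_fin n))
      exact Finset.mem_image.2 ⟨(fun a b => ⟨_, hlt p.1 p.2 a b⟩,
        fun a b => ⟨_, hlt p.1 (p.2 ∘ σ) a b⟩), Finset.mem_univ _, rfl⟩
    have h := (Finset.card_le_card hsub).trans Finset.card_image_le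
    have hc : (Finset.univ : Finset ((Fin r → Fin r → Fin (n + 1)) ×
        (Fin r → Fin r → Fin (n + 1)))).card = (n + 1) ^ (2 * r ^ 2) := by
      rw [Finset.card_univ, Fintype.card_prod]
      simp only [Fintype.card_fun, Fintype.card_fin]
      rw [← pow_mul, ← pow_add]
      ring_nf
    rw [hc] at h
    exact_mod_cast h
  have hnn : ∀ t ∈ T, ∀ x z : Fin n → Fin r,
      0 ≤ ∏ i, typeWeight t.1 t.2 (x i) (z i) (z (σ i)) := by
    intro t ht x z
    obtain ⟨p, -, rfl⟩ := Finset.mem_image.1 ht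
    exact Finset.prod_nonneg fun i _ =>
      typeWeight_nonneg (empDist_nonneg _ _) (empDist_nonneg _ _) _ _ _
  calc _ ≤ ∑ x : Fin n → Fin r, ∑ z : Fin n → Fin r,
        ρ ^ n * ∑ t ∈ T, ∏ i, typeWeight t.1 t.2 (x i) (z i) (z (σ i)) := by
        refine Finset.sum_le_sum fun x _ => Finset.sum_le_sum fun z _ => ?_
        split_ifs with h
        · refine (prod_le_of_mutualInfo_le hn hM hρ hquad σ x z h).trans
            (mul_le_mul_of_nonneg_left ?_ (pow_pos hρ n).le)
          exact Finset.single_le_sum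
            (f := fun t => ∏ i, typeWeight t.1 t.2 (x i) (z i) (z (σ i)))
            (fun t ht => hnn t ht x z)
            (Finset.mem_image_of_mem τ (Finset.mem_univ (x, z)))
        · exact mul_nonneg (pow_pos hρ n).le (Finset.sum_nonneg fun t ht => hnn t ht x z)
    _ = ρ ^ n * ∑ t ∈ T, ∑ x : Fin n → Fin r, ∑ z : Fin n → Fin r,
        ∏ i, typeWeight t.1 t.2 (x i) (z i) (z (σ i)) := by
        simp_rw [← Finset.mul_sum]
        congr 1
        rw [Finset.sum_comm]
        rw [Finset.sum_congr rfl fun x _ => Finset.sum_comm, Finset.sum_comm]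
        exact Finset.sum_congr rfl fun x _ => Finset.sum_comm
    _ ≤ ρ ^ n * ∑ _t ∈ T, (r : ℝ) ^ numCycles σ := by
        refine mul_le_mul_of_nonneg_left (Finset.sum_le_sum fun t ht => ?_) (pow_pos hρ n).le
        obtain ⟨p, -, rfl⟩ := Finset.mem_image.1 ht
        exact sum_typeWeight_le σ (empDist_nonneg _ _) (empDist_nonneg _ _)
          fun a => empDist_comp_sum_right _ _ _ _
    _ ≤ _ := by
        rw [Finset.sum_const, nsmul_eq_mul, mul_comm (ρ ^ n)]
        gcongr

end Types

/-! ### Error probabilities -/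

section ErrorProb

variable {n r : ℕ}

/-- The permutation relating the channel output to what it becomes when the delay is `d` and `d'`
is undone. -/
def relShift (d d' : Fin n) : Equiv.Perm (Fin n) := delayPerm d * (delayPerm d')⁻¹

lemma numCycles_relShift_le {D : Finset (Fin n)} {d d' : Fin n} (hd : d ∈ D) (hd' : d' ∈ D)
    (hne : d ≠ d') : numCycles (relShift d d') ≤ maxCycles D := by
  have hcomm : relShift d d' = (delayPerm d')⁻¹ * delayPerm d := by
    have h : Commute (delayPerm d) (delayPerm d') := Commute.pow_pow_self _ _ _
    exact h.inv_right.eq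
  rw [hcomm]
  exact Finset.le_sup (f := fun p : Fin n × Fin n =>
    numCycles ((delayPerm p.1)⁻¹ * delayPerm p.2)) (b := (d', d))
    (Finset.mem_offDiag.2 ⟨hd', hd, hne.symm⟩)

lemma numCycles_pos (hn : 0 < n) (σ : Equiv.Perm (Fin n)) : 0 < numCycles σ :=
  have : Nonempty (Quotient (Equiv.Perm.SameCycle.setoid σ)) := ⟨Quotient.mk _ ⟨0, hn⟩⟩
  Nat.card_pos

lemma maxCycles_pos {D : Finset (Fin n)} (hD : 2 ≤ D.card) : 0 < maxCycles D := by
  obtain ⟨d, hd, d', hd', hne⟩ := Finset.one_lt_card.1 hD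
  exact (numCycles_pos d.pos _).trans_le (numCycles_relShift_le hd hd' hne)

lemma exists_isMMI {D : Finset (Fin n)} (hD : D.Nonempty) : ∃ φ : Decoder n r, IsMMI D φ := by
  have h : ∀ x y : Fin n → Fin r, ∃ d ∈ D, ∀ d' ∈ D,
      mutualInfo (empDist x (y ∘ (delayPerm d').symm)) ≤
        mutualInfo (empDist x (y ∘ (delayPerm d).symm)) := fun x y =>
    Finset.exists_max_image D (fun d => mutualInfo (empDist x (y ∘ (delayPerm d).symm))) hD
  choose φ hφ using h
  exact ⟨φ, hφ⟩

variable {P : Fin r → ℝ} {W : Fin r → Fin r → ℝ}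

lemma seqProb_nonneg (hM : ∀ a b, 0 ≤ P a * W a b) (x z : Fin n → Fin r) :
    0 ≤ seqProb P W x z :=
  Finset.prod_nonneg fun _ _ => hM _ _

open Matrix in
/-- Union bound over the wrong delays. -/
lemma errorProb_le_of_isMMI (hr : 0 < r) (hM : ∀ a b, 0 ≤ P a * W a b) {ρ : ℝ} (hρ : 0 < ρ)
    (hquad : ∀ v : Fin r → ℝ, v ⬝ᵥ tiltedKernel (fun a b => P a * W a b) 0 *ᵥ v ≤ ρ * (v ⬝ᵥ v))
    {D : Finset (Fin n)} (hD : D.Nonempty) {φ : Decoder n r} (hφ : IsMMI D φ) :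
    errorProb P W D φ
      ≤ n * (((n : ℝ) + 1) ^ (2 * r ^ 2) * (r : ℝ) ^ maxCycles D * ρ ^ n) := by
  set C : ℝ := ((n : ℝ) + 1) ^ (2 * r ^ 2) * (r : ℝ) ^ maxCycles D * ρ ^ n with hC
  have hr1 : (1 : ℝ) ≤ r := by exact_mod_cast hr
  have hC0 : 0 ≤ C := by positivity
  have hd : ∀ d ∈ D, (∑ x : Fin n → Fin r, ∑ z : Fin n → Fin r,
      if φ x (z ∘ delayPerm d) = d then 0 else seqProb P W x z) ≤ n * C := by
    intro d hd
    calc _ ≤ ∑ x : Fin n → Fin r, ∑ z : Fin n → Fin r, ∑ d' ∈ D.erase d,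
          if mutualInfo (empDist x z) ≤ mutualInfo (empDist x (z ∘ relShift d d'))
            then seqProb P W x z else 0 := by
          refine Finset.sum_le_sum fun x _ => Finset.sum_le_sum fun z _ => ?_
          have hnn : ∀ d' ∈ D.erase d, (0 : ℝ) ≤
              if mutualInfo (empDist x z) ≤ mutualInfo (empDist x (z ∘ relShift d d'))
                then seqProb P W x z else 0 := fun d' _ => by
            split_ifs
            exacts [seqProb_nonneg hM x z, le_rfl]
          split_ifs with h
          · exact Finset.sum_nonneg hnn
          · obtain ⟨hmem, hmax⟩ := hφ x (z ∘ delayPerm d)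
            refine le_trans (le_of_eq ?_) (Finset.single_le_sum hnn (Finset.mem_erase.2 ⟨h, hmem⟩))
            have h1 : (z ∘ delayPerm d) ∘ (delayPerm d).symm = z := by
              rw [Function.comp_assoc, Equiv.self_comp_symm, Function.comp_id]
            have h2 := hmax d hd
            rw [h1] at h2
            exact (if_pos h2).symm
      _ = ∑ d' ∈ D.erase d, ∑ x : Fin n → Fin r, ∑ z : Fin n → Fin r,
          if mutualInfo (empDist x z) ≤ mutualInfo (empDist x (z ∘ relShift d d'))
            then seqProb P W x z else 0 := by
          rw [Finset.sum_comm]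
          rw [Finset.sum_congr rfl fun x _ => Finset.sum_comm, Finset.sum_comm]
          exact Finset.sum_congr rfl fun x _ => Finset.sum_comm
      _ ≤ ∑ _d' ∈ D.erase d, C := by
          refine Finset.sum_le_sum fun d' hd' => ?_
          obtain ⟨hne, hd'⟩ := Finset.mem_erase.1 hd'
          refine (sum_mutualInfo_le d.pos hM hρ hquad (relShift d d')).trans ?_
          have := pow_le_pow_right₀ hr1 (numCycles_relShift_le hd hd' hne.symm)
          rw [hC]
          gcongr
      _ ≤ n * C := by
          rw [Finset.sum_const, nsmul_eq_mul]
          refine mul_le_mul_of_nonneg_right ?_ hC0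
          exact_mod_cast (Finset.card_le_univ _).trans_eq (Fintype.card_fin n)
  have hcard : (0 : ℝ) < D.card := by exact_mod_cast hD.card_pos
  rw [errorProb, one_div, inv_mul_le_iff₀ hcard, ← nsmul_eq_mul]
  exact Finset.sum_le_card_nsmul _ _ _ hd

/-- No decoder can be right under both of two delays at the same observation, so it errs with at
least the overlap of the two laws. -/
lemma overlap_le_errorProb (hM : ∀ a b, 0 ≤ P a * W a b) {D : Finset (Fin n)} {d d' : Fin n}
    (hd : d ∈ D) (hd' : d' ∈ D) (hne : d ≠ d') (φ : Decoder n r) :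
    1 / (n : ℝ) * (∑ x : Fin n → Fin r, ∑ z : Fin n → Fin r,
      min (seqProb P W x z) (seqProb P W x (z ∘ relShift d d'))) ≤ errorProb P W D φ := by
  have hnn := seqProb_nonneg (n := n) hM
  set err : Fin n → ℝ := fun d => ∑ x : Fin n → Fin r, ∑ z : Fin n → Fin r,
    if φ x (z ∘ delayPerm d) = d then 0 else seqProb P W x z with herr
  have herr0 : ∀ d, 0 ≤ err d := fun d =>
    Finset.sum_nonneg fun x _ => Finset.sum_nonneg fun z _ => by
      split_ifs
      exacts [le_rfl, hnn x z]
  have herr' : err d' = ∑ x : Fin n → Fin r, ∑ z : Fin n → Fin r,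
      if φ x (z ∘ delayPerm d) = d' then 0 else seqProb P W x (z ∘ relShift d d') := by
    refine Finset.sum_congr rfl fun x _ => ?_
    rw [← ((relShift d d').symm.arrowCongr (Equiv.refl (Fin r))).sum_comp]
    refine Finset.sum_congr rfl fun z _ => ?_
    have h1 : ((relShift d d').symm.arrowCongr (Equiv.refl (Fin r))) z = z ∘ relShift d d' := rfl
    have h2 : (z ∘ relShift d d') ∘ delayPerm d' = z ∘ delayPerm d := by
      funext i
      simp [relShift]
    rw [h1, h2]
  have hsum : (∑ x : Fin n → Fin r, ∑ z : Fin n → Fin r,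
      min (seqProb P W x z) (seqProb P W x (z ∘ relShift d d'))) ≤ err d + err d' := by
    rw [herr', herr]
    simp only [← Finset.sum_add_distrib]
    refine Finset.sum_le_sum fun x _ => Finset.sum_le_sum fun z _ => ?_
    by_cases h : φ x (z ∘ delayPerm d) = d
    · rw [if_pos h, zero_add, if_neg fun h' => hne (h.symm.trans h')]
      exact min_le_right _ _
    · rw [if_neg h]
      refine (min_le_left _ _).trans (le_add_of_nonneg_right ?_)
      split_ifs
      exacts [le_rfl, hnn x _]
  have hpair : err d + err d' ≤ ∑ d ∈ D, err d := by
    rw [← Finset.sum_pair hne]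
    exact Finset.sum_le_sum_of_subset_of_nonneg
      (Finset.insert_subset hd (Finset.singleton_subset_iff.2 hd')) fun d _ _ => herr0 d
  have hcard : (0 : ℝ) < D.card := by exact_mod_cast Finset.card_pos.2 ⟨d, hd⟩
  have hcardn : (D.card : ℝ) ≤ n := by
    exact_mod_cast (Finset.card_le_univ _).trans_eq (Fintype.card_fin n)
  rw [errorProb]
  exact mul_le_mul (one_div_le_one_div_of_le hcard hcardn) (hsum.trans hpair)
    (Finset.sum_nonneg fun x _ => Finset.sum_nonneg fun z _ => le_min (hnn _ _) (hnn _ _))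
    (by positivity)

lemma overlap_le_optimalErrorProb (hM : ∀ a b, 0 ≤ P a * W a b) {D : Finset (Fin n)}
    {d d' : Fin n} (hd : d ∈ D) (hd' : d' ∈ D) (hne : d ≠ d') :
    1 / (n : ℝ) * (∑ x : Fin n → Fin r, ∑ z : Fin n → Fin r,
      min (seqProb P W x z) (seqProb P W x (z ∘ relShift d d'))) ≤ optimalErrorProb P W D := by
  have : Nonempty (Decoder n r) := ⟨fun _ _ => d⟩
  exact le_ciInf fun φ => overlap_le_errorProb hM hd hd' hne φ

lemma optimalErrorProb_le (D : Finset (Fin n)) (φ : Decoder n r) :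
    optimalErrorProb P W D ≤ errorProb P W D φ :=
  ciInf_le (Set.finite_range _).bddBelow φ

/-- Constant source and output sequences are invariant under every shift, so that errors cannot be
avoided. -/
lemma optimalErrorProb_pos (hM : ∀ a b, 0 ≤ P a * W a b) {a b : Fin r} (hab : 0 < P a * W a b)
    {D : Finset (Fin n)} (hD : 2 ≤ D.card) : 0 < optimalErrorProb P W D := by
  obtain ⟨d, hd, d', hd', hne⟩ := Finset.one_lt_card.1 hD
  refine lt_of_lt_of_le ?_ (overlap_le_optimalErrorProb hM hd hd' hne)
  have hn : (0 : ℝ) < n := by exact_mod_cast d.pos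
  have hnn : ∀ x z : Fin n → Fin r,
      0 ≤ min (seqProb P W x z) (seqProb P W x (z ∘ relShift d d')) := fun x z =>
    le_min (seqProb_nonneg hM _ _) (seqProb_nonneg hM _ _)
  refine mul_pos (one_div_pos.2 hn) (Finset.sum_pos' (fun x _ => Finset.sum_nonneg fun z _ =>
    hnn x z) ⟨fun _ => a, Finset.mem_univ _, Finset.sum_pos' (fun z _ => hnn _ z)
    ⟨fun _ => b, Finset.mem_univ _, lt_min ?_ ?_⟩⟩)
  · exact Finset.prod_pos fun _ _ => hab
  · exact Finset.prod_pos fun _ _ => hab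

end ErrorProb

/-! ### The error exponent -/

section Exponent

variable {r : ℕ} {P : Fin r → ℝ} {W : Fin r → Fin r → ℝ}

/-- Bernoulli's inequality, by which the cycle term of the error bound absorbs a polynomial
factor. -/
lemma log_one_add_le {n κ : ℕ} (hκ : 0 < κ) :
    Real.log (1 + n) ≤ κ * Real.log (1 + (n : ℝ) / κ) := by
  have hκ' : (0 : ℝ) < κ := by exact_mod_cast hκ
  rw [← Real.log_pow]
  refine Real.log_le_log (by positivity) ?_
  have h := one_add_mul_le_pow (a := (n : ℝ) / κ)
    (le_trans (by norm_num) (by positivity : (0 : ℝ) ≤ n / κ)) κ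
  rwa [mul_div_cancel₀ _ hκ'.ne'] at h

open Matrix in
lemma log_errorProb_le_of_isMMI (hr : 0 < r) (hM : ∀ a b, 0 ≤ P a * W a b) {a b : Fin r}
    (hab : 0 < P a * W a b) {ρ : ℝ} (hρ : 0 < ρ)
    (hquad : ∀ v : Fin r → ℝ, v ⬝ᵥ tiltedKernel (fun a b => P a * W a b) 0 *ᵥ v ≤ ρ * (v ⬝ᵥ v))
    {n : ℕ} {D : Finset (Fin n)} (hD : 2 ≤ D.card) {φ : Decoder n r} (hφ : IsMMI D φ) :
    Real.log (errorProb P W D φ) ≤ n * Real.log ρ + (2 * (r : ℝ) ^ 2 + 1) * Real.log (1 + n)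
      + maxCycles D * Real.log r := by
  have hDne : D.Nonempty := Finset.card_pos.1 (by omega)
  have hn : 0 < n := hDne.choose.pos
  have hn' : (0 : ℝ) < n := by exact_mod_cast hn
  have hr' : (0 : ℝ) < r := by exact_mod_cast hr
  have hpos := (optimalErrorProb_pos hM hab hD).trans_le (optimalErrorProb_le D φ)
  refine (Real.log_le_log hpos (errorProb_le_of_isMMI hr hM hρ hquad hDne hφ)).trans ?_
  rw [Real.log_mul hn'.ne' (by positivity), Real.log_mul (by positivity) (by positivity),
    Real.log_mul (by positivity) (by positivity), Real.log_pow, Real.log_pow, Real.log_pow,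
    add_comm (n : ℝ) 1]
  have := Real.log_le_log hn' (le_add_of_nonneg_left zero_le_one : (n : ℝ) ≤ 1 + n)
  push_cast
  linarith

open Matrix in
/-- Both bounds match on the exponential scale: the number of cycles is `o(n)`, which is all that
is used of `o(n / log n)`. -/
lemma isOptimalErrorExponent_neg_logb (hr : 0 < r) (hM : ∀ a b, 0 ≤ P a * W a b) {a b : Fin r}
    (hab : 0 < P a * W a b) {ρ : ℝ} (hρ : 0 < ρ)
    (hquad : ∀ v : Fin r → ℝ, v ⬝ᵥ tiltedKernel (fun a b => P a * W a b) 0 *ᵥ v ≤ ρ * (v ⬝ᵥ v))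
    (htr : ∀ m, ρ ^ m ≤ (tiltedKernel (fun a b => P a * W a b) 0 ^ m).trace) :
    IsOptimalErrorExponent P W (-Real.logb 2 ρ) := by
  rintro D ⟨hcard, hκ⟩
  have hlog2 : 0 < Real.log 2 := Real.log_pos one_lt_two
  have hlogn : Tendsto (fun n : ℕ => Real.log (1 + n) / n) atTop (𝓝 0) := by
    have h1 : Tendsto (fun n : ℕ => Real.log n / n) atTop (𝓝 0) := by
      have := (Real.isLittleO_log_id_atTop.comp_tendsto
        tendsto_natCast_atTop_atTop).tendsto_div_nhds_zero
      simpa [Function.comp_def] using this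
    refine squeeze_zero' (Eventually.of_forall fun n => ?_) ?_
      (by simpa using h1.const_mul 2 : Tendsto (fun n : ℕ => 2 * (Real.log n / n)) atTop (𝓝 0))
    · exact div_nonneg (Real.log_nonneg (by simp)) (Nat.cast_nonneg n)
    · filter_upwards [eventually_ge_atTop 2] with n hn
      have hn2 : (2 : ℝ) ≤ n := by exact_mod_cast hn
      have h : Real.log (1 + n) ≤ 2 * Real.log n := by
        rw [← Nat.cast_two (R := ℝ), ← Real.log_pow]
        exact Real.log_le_log (by positivity) (by nlinarith)
      rw [← mul_div_assoc]
      exact div_le_div_of_nonneg_right h (Nat.cast_nonneg n)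
  have hcyc : Tendsto (fun n : ℕ => (maxCycles (D n) : ℝ) / n) atTop (𝓝 0) := by
    refine IsLittleO.tendsto_div_nhds_zero (hκ.trans_isBigO ?_)
    refine IsBigO.of_bound 1 ?_
    filter_upwards [eventually_ge_atTop 3] with n hn
    have hn3 : (3 : ℝ) ≤ n := by exact_mod_cast hn
    have h1 : 1 ≤ Real.log n := by
      rw [Real.le_log_iff_exp_le (by linarith)]
      linarith [Real.exp_one_lt_d9]
    rw [one_mul, norm_div]
    exact div_le_self (norm_nonneg _) (h1.trans (le_abs_self _))
  refine tendsto_order.2 ⟨fun e he => ?_, fun e he => ?_⟩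
  · have hlim : Tendsto (fun n : ℕ => -Real.logb 2 ρ - ((2 * (r : ℝ) ^ 2 + 1) *
        (Real.log (1 + n) / n) + (maxCycles (D n) : ℝ) / n * Real.log r) / Real.log 2)
        atTop (𝓝 (-Real.logb 2 ρ)) := by
      simpa using (((hlogn.const_mul (2 * (r : ℝ) ^ 2 + 1)).add
        (hcyc.mul_const (Real.log r))).div_const (Real.log 2)).const_sub (-Real.logb 2 ρ)
    filter_upwards [hlim.eventually (lt_mem_nhds he), hcard] with n hn hD
    refine hn.trans_le ?_
    obtain ⟨φ, hφ⟩ := exists_isMMI (r := r) (Finset.card_pos.1 (by omega : 0 < (D n).card))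
    have hn0 : (0 : ℝ) < n := by
      exact_mod_cast (Finset.card_pos.1 (by omega : 0 < (D n).card)).choose.pos
    have h1 := (Real.log_le_log (optimalErrorProb_pos hM hab hD)
      (optimalErrorProb_le (D n) φ)).trans (log_errorProb_le_of_isMMI hr hM hab hρ hquad hD hφ)
    simp only [Real.logb]
    rw [← sub_nonneg]
    have h2 : -(1 / (n : ℝ)) * (Real.log (optimalErrorProb P W (D n)) / Real.log 2)
        - (-(Real.log ρ / Real.log 2) - ((2 * (r : ℝ) ^ 2 + 1) *
        (Real.log (1 + n) / n) + (maxCycles (D n) : ℝ) / n * Real.log r) / Real.log 2)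
        = (n * Real.log ρ + (2 * (r : ℝ) ^ 2 + 1) * Real.log (1 + n)
          + maxCycles (D n) * Real.log r - Real.log (optimalErrorProb P W (D n)))
          / (n * Real.log 2) := by
      field_simp
      ring
    rw [h2]
    exact div_nonneg (sub_nonneg.2 h1) (by positivity)
  · set δ : ℝ := (e + Real.logb 2 ρ) * Real.log 2 / 2 with hδ
    have hδ0 : 0 < δ := by
      have : 0 < e + Real.logb 2 ρ := by linarith
      positivity
    obtain ⟨η, hη, N, hN⟩ := exists_overlap_ge hr hM hρ hquad htr hδ0
    filter_upwards [hcard, eventually_ge_atTop N, hlogn.eventually (gt_mem_nhds hδ0),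
      hcyc.eventually (gt_mem_nhds hη)] with n hD hnN hln hcn
    obtain ⟨d, hd, d', hd', hne⟩ := Finset.one_lt_card.1 hD
    have hn0 : (0 : ℝ) < n := by exact_mod_cast d.pos
    rw [div_lt_iff₀ hn0] at hln hcn
    have hov := hN n hnN (relShift d d') (le_trans
      (by exact_mod_cast numCycles_relShift_le hd hd' hne) hcn.le)
    have hopt : 1 / (n : ℝ) * (Real.exp (-δ * n) * ρ ^ n) ≤ optimalErrorProb P W (D n) :=
      (mul_le_mul_of_nonneg_left hov (by positivity)).trans
        (overlap_le_optimalErrorProb hM hd hd' hne)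
    have hl := Real.log_le_log (by positivity) hopt
    rw [Real.log_mul (by positivity) (by positivity), Real.log_mul (by positivity) (by positivity),
      Real.log_exp, Real.log_pow, one_div, Real.log_inv] at hl
    have hln' : Real.log n < δ * n := (Real.log_le_log hn0
      (le_add_of_nonneg_left zero_le_one : (n : ℝ) ≤ 1 + n)).trans_lt hln
    have he2 : e * Real.log 2 = 2 * δ - Real.log ρ := by
      rw [hδ, Real.logb]
      field_simp
      ring
    have h3 : -(1 / (n : ℝ)) * Real.logb 2 (optimalErrorProb P W (D n))
        = -Real.log (optimalErrorProb P W (D n)) / (n * Real.log 2) := by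
      rw [Real.logb]; field_simp
    rw [h3, div_lt_iff₀ (by positivity)]
    have h4 : e * (n * Real.log 2) = n * (2 * δ - Real.log ρ) := by rw [← he2]; ring
    rw [h4]
    linarith

open Matrix in
lemma neg_logb_errorProb_ge_of_isMMI (hr : 0 < r) (hM : ∀ a b, 0 ≤ P a * W a b) {a b : Fin r}
    (hab : 0 < P a * W a b) {ρ : ℝ} (hρ : 0 < ρ)
    (hquad : ∀ v : Fin r → ℝ, v ⬝ᵥ tiltedKernel (fun a b => P a * W a b) 0 *ᵥ v ≤ ρ * (v ⬝ᵥ v))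
    {n : ℕ} {D : Finset (Fin n)} (hD : 2 ≤ D.card) {φ : Decoder n r} (hφ : IsMMI D φ)
    {κ : ℕ} (hκ : κ = maxCycles D) :
    -(1 / (n : ℝ)) * Real.logb 2 (errorProb P W D φ) ≥
      -Real.logb 2 ρ - (κ : ℝ) / n * ((r : ℝ) ^ 2 * ((r : ℝ) + 1)) * Real.logb 2 (1 + (n : ℝ) / κ)
        - (r : ℝ) ^ 3 * (Real.logb 2 (1 + (n : ℝ)) / n)
        - (κ : ℝ) / n * Real.logb 2 r - 1 / (n : ℝ) * Real.logb 2 κ := by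
  have hκ0 : 0 < κ := hκ ▸ maxCycles_pos hD
  have hlog2 : 0 < Real.log 2 := Real.log_pos one_lt_two
  have hn0 : (0 : ℝ) < n := by
    exact_mod_cast (Finset.card_pos.1 (by omega : 0 < D.card)).choose.pos
  have hr1 : (1 : ℝ) ≤ r := by exact_mod_cast hr
  have hle := log_errorProb_le_of_isMMI hr hM hab hρ hquad hD hφ
  rw [← hκ] at hle
  have hL0 : 0 ≤ Real.log (1 + n) := Real.log_nonneg (by linarith)
  have hcoef : (2 * (r : ℝ) ^ 2 + 1) * Real.log (1 + n)
      ≤ ((r : ℝ) ^ 2 * (r + 1)) * (κ * Real.log (1 + (n : ℝ) / κ))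
        + (r : ℝ) ^ 3 * Real.log (1 + n) := by
    have h1 := mul_le_mul_of_nonneg_left (log_one_add_le (n := n) hκ0)
      (by positivity : 0 ≤ (r : ℝ) ^ 2 * (r + 1))
    have h2 : 2 * (r : ℝ) ^ 2 + 1 ≤ (r : ℝ) ^ 2 * (r + 1) + (r : ℝ) ^ 3 := by
      have : (1 : ℝ) ≤ (r : ℝ) ^ 3 := one_le_pow₀ hr1
      nlinarith [sq_nonneg (r : ℝ)]
    have h3 := mul_le_mul_of_nonneg_right h2 hL0
    linarith
  have hlκ : 0 ≤ Real.log κ := Real.log_natCast_nonneg κ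
  simp only [Real.logb]
  rw [ge_iff_le, ← sub_nonneg]
  have hform : -(1 / (n : ℝ)) * (Real.log (errorProb P W D φ) / Real.log 2)
      - (-(Real.log ρ / Real.log 2)
        - (κ : ℝ) / n * ((r : ℝ) ^ 2 * ((r : ℝ) + 1)) * (Real.log (1 + (n : ℝ) / κ) / Real.log 2)
        - (r : ℝ) ^ 3 * (Real.log (1 + (n : ℝ)) / Real.log 2 / n)
        - (κ : ℝ) / n * (Real.log r / Real.log 2) - 1 / (n : ℝ) * (Real.log κ / Real.log 2))
      = (n * Real.log ρ + ((r : ℝ) ^ 2 * (r + 1)) * (κ * Real.log (1 + (n : ℝ) / κ))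
        + (r : ℝ) ^ 3 * Real.log (1 + n) + κ * Real.log r + Real.log κ
        - Real.log (errorProb P W D φ)) / (n * Real.log 2) := by
    generalize Real.log (1 + (n : ℝ) / κ) = l
    field_simp
    ring
  rw [hform]
  exact div_nonneg (by linarith) (by positivity)

end Exponent

end DelayEstimation

theorem mainTheorem4 (r : ℕ) (P : Fin r → ℝ) (hP : P ∈ stdSimplex ℝ (Fin r))
    (W : Fin r → Fin r → ℝ) (hW : ∀ a, W a ∈ stdSimplex ℝ (Fin r)) :
    ∃ E : ℝ, DelayEstimation.IsOptimalErrorExponent P W E ∧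
      ∀ (n : ℕ) (D : Finset (Fin n)), 2 ≤ D.card →
        ∀ φ : DelayEstimation.Decoder n r, DelayEstimation.IsMMI D φ →
          ∀ κ : ℕ, κ = DelayEstimation.maxCycles D →
            -(1 / (n : ℝ)) * Real.logb 2 (DelayEstimation.errorProb P W D φ) ≥
              E - (κ : ℝ) / n * ((r : ℝ) ^ 2 * ((r : ℝ) + 1)) * Real.logb 2 (1 + (n : ℝ) / κ)
                - (r : ℝ) ^ 3 * (Real.logb 2 (1 + (n : ℝ)) / n)
                - (κ : ℝ) / n * Real.logb 2 r
                - 1 / (n : ℝ) * Real.logb 2 κ := by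
  have hM : ∀ a b, 0 ≤ P a * W a b := fun a b => mul_nonneg (hP.1 a) ((hW a).1 b)
  obtain ⟨a, -, ha⟩ : ∃ a ∈ Finset.univ, 0 < P a :=
    Finset.exists_lt_of_sum_lt (by simp [hP.2])
  obtain ⟨b, -, hb⟩ : ∃ b ∈ Finset.univ, 0 < W a b :=
    Finset.exists_lt_of_sum_lt (by simp [(hW a).2])
  have hab : 0 < P a * W a b := mul_pos ha hb
  have : Nonempty (Fin r) := ⟨a⟩
  have hpsd : (DelayEstimation.tiltedKernel (fun a b => P a * W a b) 0).PosSemidef := by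
    rw [DelayEstimation.tiltedKernel_zero]
    exact Matrix.posSemidef_conjTranspose_mul_self _
  obtain ⟨ρ, -, hquad, htr⟩ := DelayEstimation.exists_topEigenvalue hpsd
  have hρ : 0 < ρ := by
    -- The diagonal entry of the kernel at `b` is positive and at most `ρ`.
    have h := hquad (Pi.single b 1)
    simp only [Matrix.mulVec_single_one, single_one_dotProduct, Pi.single_eq_same, mul_one,
      Matrix.col_apply] at h
    refine lt_of_lt_of_le ?_ h
    refine Finset.sum_pos' (fun a' _ => mul_nonneg (Real.rpow_nonneg (hM _ _) _)
      (Real.rpow_nonneg (hM _ _) _)) ⟨a, Finset.mem_univ _, ?_⟩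
    exact mul_pos (Real.rpow_pos_of_pos hab _) (Real.rpow_pos_of_pos hab _)
  exact ⟨-Real.logb 2 ρ,
    DelayEstimation.isOptimalErrorExponent_neg_logb a.pos hM hab hρ hquad htr,
    fun n D hD φ hφ κ hκ =>
      DelayEstimation.neg_logb_errorProb_ge_of_isMMI a.pos hM hab hρ hquad hD hφ hκ⟩
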